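/- Let $X=\mathbb{R}\times\mathbb{S}^1$ with $\mathbb{S}^1=\mathbb{R}/2\pi\mathbb{Z}$, equipped with Lebesgue measure $dx\,dy$ (so that $\mathbb{S}^1$ has length $2\pi$), and let $L^2_0(X)$ be the orthogonal complement, in the complex Hilbert space $L^2(X)$, of the functions that depend only on $x$. For $s\in\mathbb{R}$ let $P_s$ be the operator on $L^2_0(X)$ $$P_s u=-\partial_x^2u-(x^2+s^2)\,\partial_y^2u,$$ with domain $\{u\in L^2_0(X):\ \partial_x^2u\in L^2(X),\ (x^2+s^2)\,\partial_y^2u\in L^2(X)\}$, where the derivatives are taken in the sense of distributions on $X$. Write $\mathbb{N}=\{0,1,2,\dots\}$, $\mathbb{Z}^*=\mathbb{Z}\setminus\{0\}$ and $$E^s_{k,n}=(2n+1)|k|+k^2s^2,\qquad n\in\mathbb{N},\ k\in\mathbb{Z}^*.$$ Then, for every $s\in\mathbb{R}$, the spectrum of $P_s$ (the complement in $\mathbb{C}$ of its resolvent set) is $$\mathrm{spec}(P_s)=\{E^s_{k,n}:\ n\in\mathbb{N},\ k\in\mathbb{Z}^*\}.$$ Moreover the functions $$\phi_{k,n}(x,y)=c_n\,|k|^{1/4}\,H_n\!\left(x\sqrt{|k|}\right)e^{-x^2|k|/2}\,e^{iky},\qquad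 c_n=\left(2^n\,n!\,\sqrt{\pi}\cdot 2\pi\right)^{-1/2},\quad n\in\mathbb{N},\ k\in\mathbb{Z}^*,$$ where $H_n(t)=(-1)^ne^{t^2}\frac{d^n}{dt^n}e^{-t^2}$ is the Hermite polynomial of degree $n$, lie in the domain of $P_s$, satisfy $P_s\phi_{k,n}=E^s_{k,n}\phi_{k,n}$, and form an orthonormal (Hilbert) basis of $L^2_0(X)$. -/

import Mathlib

open MeasureTheory Set Filter Topology
open scoped ContDiff

namespace Grushin

noncomputable section

/-! ### The cylinder and its Lebesgue measure -/

instance twoPiPos : Fact (0 < 2 * Real.pi) := ⟨Real.two_pi_pos⟩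

/-- The circle `𝕊¹ = ℝ / 2πℤ`; its `volume` is Lebesgue measure `dy`, of total mass `2π`. -/
abbrev Circ : Type := AddCircle (2 * Real.pi)

/-- The infinite cylinder `X = ℝ × 𝕊¹`; its `volume` is the product measure `dx dy`. -/
abbrev Cyl : Type := ℝ × Circ

/-- The complex Hilbert space `L²(X)`. -/
abbrev L2X : Type := Lp ℂ 2 (volume : Measure Cyl)

/-- The square integrable functions on `X` that depend only on `x`. -/
def fnsOfX : Submodule ℂ L2X where
  carrier := {u | ∃ f : ℝ → ℂ, u =ᵐ[volume] fun p : Cyl => f p.1}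
  zero_mem' := ⟨0, by filter_upwards [Lp.coeFn_zero ℂ 2 (volume : Measure Cyl)] with p hp; exact hp⟩
  add_mem' := by
    rintro u v ⟨f, hf⟩ ⟨g, hg⟩
    refine ⟨f + g, ?_⟩
    filter_upwards [Lp.coeFn_add u v, hf, hg] with p h1 h2 h3
    rw [h1, Pi.add_apply, Pi.add_apply, h2, h3]
  smul_mem' := by
    rintro c u ⟨f, hf⟩
    refine ⟨c • f, ?_⟩
    filter_upwards [Lp.coeFn_smul c u, hf] with p h1 h2
    rw [h1, Pi.smul_apply, Pi.smul_apply, h2]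

/-- `L²₀(X)`, the orthogonal complement in `L²(X)` of the functions that depend only on `x`. -/
def L20 : Submodule ℂ L2X := fnsOfXᗮ

instance : CompleteSpace L20 := inferInstanceAs (CompleteSpace fnsOfXᗮ)

/-! ### Test functions and partial derivatives on the cylinder -/

/-- Complex test functions on `X`: smooth (that is, smooth when lifted to the universal cover
`ℝ × ℝ`) and compactly supported. -/
structure IsTest (φ : Cyl → ℂ) : Prop where
  smooth : ContDiff ℝ ∞ (fun p : ℝ × ℝ => φ (p.1, (p.2 : Circ)))
  compact : HasCompactSupport φ

/-- The partial derivative `∂ₓ`. -/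
def dx (φ : Cyl → ℂ) : Cyl → ℂ := fun p => deriv (fun t : ℝ => φ (t, p.2)) p.1

/-- The partial derivative `∂_y`, along the rotation field of the circle. -/
def dy (φ : Cyl → ℂ) : Cyl → ℂ := fun p => deriv (fun t : ℝ => φ (p.1, p.2 + (t : Circ))) 0

/-- `g = ∂ₓ² u` in the sense of distributions on `X`. -/
def IsWeakDxx (u g : L2X) : Prop :=
  ∀ φ : Cyl → ℂ, IsTest φ → ∫ p, u p * dx (dx φ) p = ∫ p, g p * φ p

/-- `h = V(x) ∂_y² u` in the sense of distributions on `X`, where `V` depends only on `x`. -/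
def IsWeakVDyy (V : C(ℝ, ℝ)) (u h : L2X) : Prop :=
  ∀ φ : Cyl → ℂ, IsTest φ → ∫ p, u p * ((V p.1 : ℂ) * dy (dy φ) p) = ∫ p, h p * φ p

/-! ### Facts that make the operator well defined -/

theorem IsTest.dx_lift {φ : Cyl → ℂ} (hφ : IsTest φ) (x y : ℝ) :
    dx φ (x, (y : Circ)) =
      fderiv ℝ (fun p : ℝ × ℝ => φ (p.1, (p.2 : Circ))) (x, y) (1, 0) := by
  have h := ((hφ.smooth.differentiable (by simp)) (x, y)).hasFDerivAt
  have h2 : HasDerivAt (fun t : ℝ => (t, y)) ((1 : ℝ), (0 : ℝ)) x :=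
    (hasDerivAt_id x).prodMk (hasDerivAt_const x y)
  exact (h.comp_hasDerivAt x h2).deriv

theorem IsTest.dy_lift {φ : Cyl → ℂ} (hφ : IsTest φ) (x y : ℝ) :
    dy φ (x, (y : Circ)) =
      fderiv ℝ (fun p : ℝ × ℝ => φ (p.1, (p.2 : Circ))) (x, y) (0, 1) := by
  have h := ((hφ.smooth.differentiable (by simp)) (x, y)).hasFDerivAt
  have h2 : HasDerivAt (fun t : ℝ => (x, y + t)) ((0 : ℝ), (1 : ℝ)) 0 :=
    (hasDerivAt_const (0 : ℝ) x).prodMk ((hasDerivAt_id (0 : ℝ)).const_add y)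
  have h' : HasFDerivAt (fun p : ℝ × ℝ => φ (p.1, (p.2 : Circ)))
      (fderiv ℝ (fun p : ℝ × ℝ => φ (p.1, (p.2 : Circ))) (x, y)) (x, y + 0) := by
    simpa using h
  have h3 := (h'.comp_hasDerivAt (0 : ℝ) h2).deriv
  simpa [dy, Function.comp_def] using h3

theorem smooth_fderiv_apply {F : ℝ × ℝ → ℂ} (hF : ContDiff ℝ ∞ F) (v : ℝ × ℝ) :
    ContDiff ℝ ∞ (fun p => fderiv ℝ F p v) :=
  (hF.fderiv_right (m := ∞) (by simp)).clm_apply contDiff_const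

theorem IsTest.dx {φ : Cyl → ℂ} (hφ : IsTest φ) : IsTest (dx φ) := by
  refine ⟨?_, ?_⟩
  · have := smooth_fderiv_apply hφ.smooth (1, 0)
    exact (funext fun p : ℝ × ℝ => hφ.dx_lift p.1 p.2) ▸ this
  · refine HasCompactSupport.intro hφ.compact fun p hp => ?_
    have h0 := notMem_tsupport_iff_eventuallyEq.1 hp
    have hc : Tendsto (fun t : ℝ => (t, p.2)) (𝓝 p.1) (𝓝 p) := by
      have : Continuous (fun t : ℝ => (t, p.2)) := by fun_prop
      simpa using this.tendsto p.1
    have h1 : (fun t : ℝ => φ (t, p.2)) =ᶠ[𝓝 p.1] fun _ => 0 := hc.eventually h0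
    simp [Grushin.dx, h1.deriv_eq]

theorem IsTest.dy {φ : Cyl → ℂ} (hφ : IsTest φ) : IsTest (dy φ) := by
  refine ⟨?_, ?_⟩
  · have := smooth_fderiv_apply hφ.smooth (0, 1)
    exact (funext fun p : ℝ × ℝ => hφ.dy_lift p.1 p.2) ▸ this
  · refine HasCompactSupport.intro hφ.compact fun p hp => ?_
    have h0 := notMem_tsupport_iff_eventuallyEq.1 hp
    have hc : Tendsto (fun t : ℝ => (p.1, p.2 + (t : Circ))) (𝓝 0) (𝓝 p) := by
      have : Continuous (fun t : ℝ => (p.1, p.2 + (t : Circ))) :=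
        continuous_const.prodMk (continuous_const.add (AddCircle.continuous_mk' _))
      simpa using this.tendsto 0
    have h1 : (fun t : ℝ => φ (p.1, p.2 + (t : Circ))) =ᶠ[𝓝 0] fun _ => 0 := hc.eventually h0
    simp [Grushin.dy, h1.deriv_eq]

theorem IsTest.continuous {φ : Cyl → ℂ} (hφ : IsTest φ) : Continuous φ := by
  have hq : IsOpenQuotientMap (Prod.map (id : ℝ → ℝ) ((↑) : ℝ → Circ)) :=
    IsOpenQuotientMap.id.prodMap QuotientAddGroup.isOpenQuotientMap_mk
  exact hq.isQuotientMap.continuous_iff.2 hφ.smooth.continuous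

theorem integrable_mul (u : L2X) {ψ : Cyl → ℂ} (hc : Continuous ψ) (hs : HasCompactSupport ψ) :
    Integrable (fun p => u p * ψ p) :=
  (Lp.memLp u).integrable_mul (q := 2) (hc.memLp_of_hasCompactSupport hs)

theorem integrable_dxx (u : L2X) {φ : Cyl → ℂ} (hφ : IsTest φ) :
    Integrable (fun p => u p * Grushin.dx (Grushin.dx φ) p) :=
  integrable_mul u hφ.dx.dx.continuous hφ.dx.dx.compact

theorem integrable_Vdyy (V : C(ℝ, ℝ)) (u : L2X) {φ : Cyl → ℂ} (hφ : IsTest φ) :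
    Integrable (fun p => u p * ((V p.1 : ℂ) * Grushin.dy (Grushin.dy φ) p)) := by
  refine integrable_mul u ?_ (hφ.dy.dy.compact.mul_left)
  have := hφ.dy.dy.continuous
  fun_prop

theorem integral_add_mul (u v : L2X) (ψ : Cyl → ℂ) (hu : Integrable (fun p => u p * ψ p))
    (hv : Integrable (fun p => v p * ψ p)) :
    ∫ p, (u + v : L2X) p * ψ p = (∫ p, u p * ψ p) + ∫ p, v p * ψ p := by
  rw [← integral_add hu hv]
  refine integral_congr_ae ?_
  filter_upwards [Lp.coeFn_add u v] with p hp
  rw [hp, Pi.add_apply, add_mul]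

theorem integral_smul_mul (c : ℂ) (u : L2X) (ψ : Cyl → ℂ) :
    ∫ p, (c • u : L2X) p * ψ p = c * ∫ p, u p * ψ p := by
  rw [← integral_const_mul]
  refine integral_congr_ae ?_
  filter_upwards [Lp.coeFn_smul c u] with p hp
  rw [hp, Pi.smul_apply, smul_eq_mul, mul_assoc]

theorem IsWeakDxx.add {u g u' g' : L2X} (h : IsWeakDxx u g) (h' : IsWeakDxx u' g') :
    IsWeakDxx (u + u') (g + g') := fun φ hφ => by
  rw [integral_add_mul _ _ _ (integrable_dxx u hφ) (integrable_dxx u' hφ),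
    integral_add_mul _ _ _ (integrable_mul g hφ.continuous hφ.compact)
      (integrable_mul g' hφ.continuous hφ.compact), h φ hφ, h' φ hφ]

theorem IsWeakDxx.smul {u g : L2X} (c : ℂ) (h : IsWeakDxx u g) :
    IsWeakDxx (c • u) (c • g) := fun φ hφ => by
  rw [integral_smul_mul, integral_smul_mul, h φ hφ]

theorem IsWeakVDyy.add {V : C(ℝ, ℝ)} {u g u' g' : L2X} (h : IsWeakVDyy V u g)
    (h' : IsWeakVDyy V u' g') : IsWeakVDyy V (u + u') (g + g') := fun φ hφ => by
  rw [integral_add_mul _ _ _ (integrable_Vdyy V u hφ) (integrable_Vdyy V u' hφ),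
    integral_add_mul _ _ _ (integrable_mul g hφ.continuous hφ.compact)
      (integrable_mul g' hφ.continuous hφ.compact), h φ hφ, h' φ hφ]

theorem IsWeakVDyy.smul {V : C(ℝ, ℝ)} {u g : L2X} (c : ℂ) (h : IsWeakVDyy V u g) :
    IsWeakVDyy V (c • u) (c • g) := fun φ hφ => by
  rw [integral_smul_mul, integral_smul_mul, h φ hφ]

theorem fourier_mk (k : ℤ) (y : ℝ) :
    fourier k (y : Circ) = Complex.exp (Complex.I * k * y) := by
  rw [fourier_coe_apply]
  congr 1
  have : (Real.pi : ℂ) ≠ 0 := by exact_mod_cast Real.pi_ne_zero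
  push_cast
  field_simp

/-- The products `a(x) e^{iky}` are test functions. -/
theorem isTest_mul_fourier {a : ℝ → ℝ} (ha : ContDiff ℝ ∞ a) (hs : HasCompactSupport a) (k : ℤ) :
    IsTest (fun p : Cyl => (a p.1 : ℂ) * fourier k p.2) := by
  refine ⟨?_, ?_⟩
  · simp only [fourier_mk]
    have h1 : ContDiff ℝ ∞ (fun p : ℝ × ℝ => ((a p.1 : ℝ) : ℂ)) :=
      Complex.ofRealCLM.contDiff.comp (ha.comp contDiff_fst)
    have h2 : ContDiff ℝ ∞ (fun p : ℝ × ℝ => ((p.2 : ℝ) : ℂ)) :=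
      Complex.ofRealCLM.contDiff.comp contDiff_snd
    exact h1.mul (contDiff_const.mul h2).cexp
  · refine HasCompactSupport.intro (K := tsupport a ×ˢ univ) (hs.isCompact.prod isCompact_univ) ?_
    intro p hp
    have : p.1 ∉ tsupport a := fun h => hp ⟨h, mem_univ _⟩
    simp [image_eq_zero_of_notMem_tsupport this]

/-- If `h ∈ L²(X)` annihilates all `a(x) e^{iky}` for a fixed `k`, then the `k`-th Fourier mode
of `h` vanishes. -/
theorem mode_eq_zero (h : L2X) (k : ℤ)
    (hk : ∀ a : ℝ → ℝ, ContDiff ℝ ∞ a → HasCompactSupport a →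
      ∫ p : Cyl, h p * ((a p.1 : ℂ) * fourier k p.2) = 0) :
    ∀ᵐ x : ℝ, ∫ y : Circ, h (x, y) * fourier k y = 0 := by
  have hloc : LocallyIntegrable (fun x : ℝ => ∫ y : Circ, h (x, y) * fourier k y) := by
    rw [locallyIntegrable_iff]
    intro K hK
    have hfin : IsFiniteMeasure ((volume : Measure Cyl).restrict (K ×ˢ univ)) :=
      ⟨by simpa using (hK.prod (isCompact_univ (X := Circ))).measure_lt_top⟩
    have h1 : Integrable h ((volume : Measure Cyl).restrict (K ×ˢ univ)) :=
      ((Lp.memLp h).restrict _).integrable (by norm_num)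
    have h2 : Integrable (fun p : Cyl => h p * fourier k p.2)
        ((volume : Measure Cyl).restrict (K ×ˢ univ)) := by
      refine h1.mul_bdd (c := 1) ?_ ?_
      · exact Continuous.aestronglyMeasurable (by fun_prop)
      · exact Eventually.of_forall fun p => (Circle.norm_coe _).le
    have h3 : (volume : Measure Cyl).restrict (K ×ˢ univ)
        = (volume.restrict K).prod (volume : Measure Circ) := by
      rw [Measure.volume_eq_prod, ← Measure.prod_restrict, Measure.restrict_univ]
    rw [h3] at h2
    exact h2.integral_prod_left
  refine ae_eq_zero_of_integral_contDiff_smul_eq_zero hloc fun a ha hs => ?_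
  have ht := isTest_mul_fourier ha hs k
  have e := integral_prod (μ := (volume : Measure ℝ)) (ν := (volume : Measure Circ)) _
    (integrable_mul h ht.continuous ht.compact)
  rw [← hk a ha hs]
  refine Eq.trans ?_ e.symm
  refine integral_congr_ae (Eventually.of_forall fun x => ?_)
  simp only [Complex.real_smul]
  rw [← integral_const_mul]
  refine integral_congr_ae (Eventually.of_forall fun y => ?_)
  change (a x : ℂ) * (h (x, y) * fourier k y) = h (x, y) * ((a x : ℂ) * fourier k y)
  ring

/-- A square integrable function on the circle all of whose Fourier coefficients vanish is zero. -/
theorem circ_eq_zero {f : Circ → ℂ} (hf : MemLp f 2 volume)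
    (h : ∀ k : ℤ, ∫ y : Circ, f y * fourier k y = 0) : f =ᵐ[volume] 0 := by
  have hf' : MemLp f 2 (AddCircle.haarAddCircle (T := 2 * Real.pi)) :=
    memLp_haarAddCircle_iff.2 hf
  have h0 : hf'.toLp f = 0 := by
    apply (fourierBasis (T := 2 * Real.pi)).repr.injective
    ext k
    rw [fourierBasis_repr, fourierCoeff_congr_ae hf'.coeFn_toLp, fourierCoeff,
      AddCircle.integral_haarAddCircle]
    have e : (fun t : Circ => fourier (-k) t • f t) = fun t => f t * fourier (-k) t :=
      funext fun t => mul_comm _ _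
    rw [e, h (-k)]
    simp
  have h1 : f =ᵐ[AddCircle.haarAddCircle (T := 2 * Real.pi)] 0 := by
    have h2 := hf'.coeFn_toLp
    rw [h0] at h2
    exact h2.symm.trans (Lp.coeFn_zero _ _ _)
  rw [AddCircle.volume_eq_smul_haarAddCircle]
  exact Measure.smul_absolutelyContinuous.ae_le h1

/-- Fundamental lemma of the calculus of variations on the cylinder. -/
theorem eq_zero_of_test (h : L2X) (hh : ∀ φ : Cyl → ℂ, IsTest φ → ∫ p, h p * φ p = 0) :
    h = 0 := by
  have h1 : ∀ᵐ x : ℝ, ∀ k : ℤ, ∫ y : Circ, h (x, y) * fourier k y = 0 :=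
    ae_all_iff.2 fun k => mode_eq_zero h k fun a ha hs => hh _ (isTest_mul_fourier ha hs k)
  have hi : Integrable (fun p => ‖h p‖ ^ 2) ((volume : Measure ℝ).prod (volume : Measure Circ)) := by
    rw [← Measure.volume_eq_prod]
    exact (memLp_two_iff_integrable_sq_norm (Lp.aestronglyMeasurable h)).1 (Lp.memLp h)
  have h2 : ∀ᵐ x : ℝ, ∫ y : Circ, ‖h (x, y)‖ ^ 2 = 0 := by
    have hm : ∀ᵐ x : ℝ, AEStronglyMeasurable (fun y : Circ => h (x, y)) volume := by
      have h0 : AEStronglyMeasurable (h : Cyl → ℂ)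
          ((volume : Measure ℝ).prod (volume : Measure Circ)) := Lp.aestronglyMeasurable h
      exact h0.prodMk_left
    filter_upwards [h1, hi.prod_right_ae, hm] with x hx1 hx2 hx3
    have := circ_eq_zero ((memLp_two_iff_integrable_sq_norm hx3).2 hx2) hx1
    rw [integral_eq_zero_of_ae]
    filter_upwards [this] with y hy
    simp [hy]
  have h3 : ∫ p, ‖h p‖ ^ 2 ∂((volume : Measure ℝ).prod (volume : Measure Circ)) = 0 := by
    rw [integral_prod _ hi, integral_eq_zero_of_ae h2]
  rw [integral_eq_zero_iff_of_nonneg (fun p => by positivity) hi,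
    ← Measure.volume_eq_prod] at h3
  rw [Lp.eq_zero_iff_ae_eq_zero]
  filter_upwards [h3] with p hp
  simpa using hp

theorem eq_of_test {g h : L2X}
    (hh : ∀ φ : Cyl → ℂ, IsTest φ → ∫ p, g p * φ p = ∫ p, h p * φ p) : g = h := by
  rw [← sub_eq_zero]
  refine eq_zero_of_test _ fun φ hφ => ?_
  have hi := fun u : L2X => integrable_mul u hφ.continuous hφ.compact
  have e : g - h = g + (-1 : ℂ) • h := by simp [sub_eq_add_neg]
  rw [e, integral_add_mul _ _ _ (hi _) (hi _), integral_smul_mul, hh φ hφ]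
  ring

theorem IsWeakDxx.unique {u g g' : L2X} (h : IsWeakDxx u g) (h' : IsWeakDxx u g') : g = g' :=
  eq_of_test fun φ hφ => (h φ hφ).symm.trans (h' φ hφ)

theorem IsWeakVDyy.unique {V : C(ℝ, ℝ)} {u g g' : L2X} (h : IsWeakVDyy V u g)
    (h' : IsWeakVDyy V u g') : g = g' :=
  eq_of_test fun φ hφ => (h φ hφ).symm.trans (h' φ hφ)

/-- Functions with vanishing integral over almost every circle belong to `L²₀(X)`. -/
theorem mem_L20_of_mean (h : L2X) (hh : ∀ᵐ x : ℝ, ∫ y : Circ, h (x, y) = 0) : h ∈ L20 := by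
  rw [L20, Submodule.mem_orthogonal]
  rintro v ⟨f, hf⟩
  have hi := L2.integrable_inner (𝕜 := ℂ) v h
  have hE : (fun p => inner ℂ (v p) (h p)) =ᵐ[volume]
      fun p : Cyl => h p * (starRingEnd ℂ) (f p.1) := by
    filter_upwards [hf] with p hp
    simp [hp, RCLike.inner_apply]
  rw [L2.inner_def, integral_congr_ae hE]
  have hi' : Integrable (fun p : Cyl => h p * (starRingEnd ℂ) (f p.1))
      ((volume : Measure ℝ).prod (volume : Measure Circ)) := hi.congr hE
  refine (integral_prod _ hi').trans ?_
  refine integral_eq_zero_of_ae ?_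
  filter_upwards [hh] with x hx
  simp only [Pi.zero_apply]
  rw [integral_mul_const, hx, zero_mul]

theorem integral_eq_zero_of_mem_L20 {u : L2X} (hu : u ∈ L20) {a : ℝ → ℝ} (ha : Continuous a)
    (hs : HasCompactSupport a) : ∫ p : Cyl, u p * (a p.1 : ℂ) = 0 := by
  have hc : Continuous (fun p : Cyl => (a p.1 : ℂ)) := by fun_prop
  have hsup : HasCompactSupport (fun p : Cyl => (a p.1 : ℂ)) := by
    refine HasCompactSupport.intro (K := tsupport a ×ˢ univ) (hs.isCompact.prod isCompact_univ) ?_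
    intro p hp
    have : p.1 ∉ tsupport a := fun h => hp ⟨h, mem_univ _⟩
    simp [image_eq_zero_of_notMem_tsupport this]
  have hm : MemLp (fun p : Cyl => (a p.1 : ℂ)) 2 volume := hc.memLp_of_hasCompactSupport hsup
  have h0 := (Submodule.mem_orthogonal _ _).1 hu (hm.toLp _)
    ⟨fun x => (a x : ℂ), hm.coeFn_toLp⟩
  rw [L2.inner_def] at h0
  rw [← h0]
  refine integral_congr_ae ?_
  filter_upwards [hm.coeFn_toLp] with p hp
  simp [hp, RCLike.inner_apply]

theorem dx_ofX (a : ℝ → ℝ) (ha : Differentiable ℝ a) :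
    dx (fun p : Cyl => ((a p.1 : ℝ) : ℂ)) = fun p => ((deriv a p.1 : ℝ) : ℂ) := by
  funext p
  exact (ha p.1).hasDerivAt.ofReal_comp.deriv

theorem IsWeakDxx.mem_L20 {u g : L2X} (hu : u ∈ L20) (h : IsWeakDxx u g) : g ∈ L20 := by
  refine mem_L20_of_mean g ?_
  have := mode_eq_zero g 0 fun a ha hs => ?_
  · simpa using this
  · have ht := isTest_mul_fourier ha hs 0
    have e := h _ ht
    rw [← e]
    have hd : ContDiff ℝ ∞ (deriv a) := by
      have := ha.iterate_deriv 1
      simpa using this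
    simp only [fourier_zero, mul_one]
    rw [dx_ofX a (ha.differentiable (by simp)), dx_ofX _ (hd.differentiable (by simp))]
    exact integral_eq_zero_of_mem_L20 hu (hd.continuous_deriv (by simp)) hs.deriv.deriv

theorem IsWeakVDyy.mem_L20 {V : C(ℝ, ℝ)} {u g : L2X} (h : IsWeakVDyy V u g) : g ∈ L20 := by
  refine mem_L20_of_mean g ?_
  have := mode_eq_zero g 0 fun a ha hs => ?_
  · simpa using this
  · have ht := isTest_mul_fourier ha hs 0
    rw [← h _ ht]
    simp [Grushin.dy]

/-! ### The Baouendi-Grushin operator -/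

/-- The domain of `P_V`: all `u ∈ L²₀(X)` such that `∂ₓ² u` and `V(x) ∂_y² u` are in `L²(X)`. -/
def grushinDomain (V : C(ℝ, ℝ)) : Submodule ℂ L20 where
  carrier := {u | (∃ g, IsWeakDxx u g) ∧ ∃ h, IsWeakVDyy V u h}
  zero_mem' := by
    refine ⟨⟨(0 : ℂ) • 0, ?_⟩, ⟨(0 : ℂ) • 0, ?_⟩⟩ <;> intro φ _ <;>
    · rw [show ((0 : L20) : L2X) = (0 : ℂ) • 0 by simp, integral_smul_mul, integral_smul_mul]
      simp
  add_mem' := by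
    rintro u v ⟨⟨g, hg⟩, ⟨h, hh⟩⟩ ⟨⟨g', hg'⟩, ⟨h', hh'⟩⟩
    exact ⟨⟨_, hg.add hg'⟩, ⟨_, hh.add hh'⟩⟩
  smul_mem' := by
    rintro c u ⟨⟨g, hg⟩, ⟨h, hh⟩⟩
    exact ⟨⟨_, hg.smul c⟩, ⟨_, hh.smul c⟩⟩

/-- `∂ₓ² u` as an element of `L²(X)`, for `u` in the domain. -/
def weakDxx {V : C(ℝ, ℝ)} (u : grushinDomain V) : L2X := u.2.1.choose

/-- `V(x) ∂_y² u` as an element of `L²(X)`, for `u` in the domain. -/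
def weakVDyy {V : C(ℝ, ℝ)} (u : grushinDomain V) : L2X := u.2.2.choose

theorem weakDxx_spec {V : C(ℝ, ℝ)} (u : grushinDomain V) :
    IsWeakDxx ((u : L20) : L2X) (weakDxx u) := u.2.1.choose_spec

theorem weakVDyy_spec {V : C(ℝ, ℝ)} (u : grushinDomain V) :
    IsWeakVDyy V ((u : L20) : L2X) (weakVDyy u) := u.2.2.choose_spec

/-- The generalized Baouendi-Grushin operator `P_V = -∂ₓ² - V(x) ∂_y²` on `L²₀(X)`. -/
def grushin (V : C(ℝ, ℝ)) : L20 →ₗ.[ℂ] L20 where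
  domain := grushinDomain V
  toFun :=
    { toFun := fun u => ⟨-weakDxx u - weakVDyy u,
        L20.sub_mem (L20.neg_mem ((weakDxx_spec u).mem_L20 (u : L20).2)) (weakVDyy_spec u).mem_L20⟩
      map_add' := fun u v => by
        ext1
        have h1 := (weakDxx_spec (u + v)).unique ((weakDxx_spec u).add (weakDxx_spec v))
        have h2 := (weakVDyy_spec (u + v)).unique ((weakVDyy_spec u).add (weakVDyy_spec v))
        simp only [Submodule.coe_add, h1, h2]
        abel
      map_smul' := fun c u => by
        ext1
        have h1 := (weakDxx_spec (c • u)).unique ((weakDxx_spec u).smul c)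
        have h2 := (weakVDyy_spec (c • u)).unique ((weakVDyy_spec u).smul c)
        simp only [Submodule.coe_smul, h1, h2, RingHom.id_apply]
        module }

/-- `P_s = P_V` for `V(x) = x² + s²`. -/
def grushinS (s : ℝ) : L20 →ₗ.[ℂ] L20 := grushin ⟨fun x => x ^ 2 + s ^ 2, by fun_prop⟩

/-! ### Spectrum of an unbounded operator -/

/-- `z` is in the resolvent set of `T` if `T - z`, from the domain of `T` to `H`, has a bounded
two-sided inverse `R : H → H`. -/
def InResolventSet {H : Type*} [NormedAddCommGroup H] [InnerProductSpace ℂ H]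
    (T : H →ₗ.[ℂ] H) (z : ℂ) : Prop :=
  ∃ R : H →L[ℂ] H,
    (∀ f : H, ∃ hf : R f ∈ T.domain, T ⟨R f, hf⟩ - z • R f = f) ∧
    ∀ u : T.domain, R (T u - z • (u : H)) = u

/-- The spectrum of an unbounded operator: the complement of its resolvent set. -/
def spec {H : Type*} [NormedAddCommGroup H] [InnerProductSpace ℂ H] (T : H →ₗ.[ℂ] H) : Set ℂ :=
  {z | ¬ InResolventSet T z}

/-! ### Hermite functions -/

/-- The physicists' Hermite polynomial `Hₙ(t) = (-1)ⁿ e^{t²} (d/dt)ⁿ e^{-t²}`, written through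
Mathlib's (probabilists') Hermite polynomial `Heₙ` as `Hₙ(t) = 2^{n/2} Heₙ(√2 t)`. -/
def hermiteH (n : ℕ) (t : ℝ) : ℝ :=
  Real.sqrt 2 ^ n * Polynomial.aeval (Real.sqrt 2 * t) (Polynomial.hermite n)

/-- The normalizing constant `(2ⁿ n! √π · 2π)^{-1/2}`. -/
def hermiteConst (n : ℕ) : ℝ :=
  (Real.sqrt (2 ^ n * n.factorial * Real.sqrt Real.pi * (2 * Real.pi)))⁻¹

/-- `φ_{k,n}(x, y) = cₙ |k|^{1/4} Hₙ(x √|k|) e^{-x² |k| / 2} e^{iky}`; here `fourier k y` is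
`e^{iky}`. -/
def eigenfn (k : ℤ) (n : ℕ) (p : Cyl) : ℂ :=
  ((hermiteConst n * |(k : ℝ)| ^ (1 / 4 : ℝ) * hermiteH n (p.1 * Real.sqrt |(k : ℝ)|)
    * Real.exp (-(p.1 ^ 2 * |(k : ℝ)|) / 2) : ℝ) : ℂ) * fourier k p.2

/-- `E^s_{k,n} = (2n+1)|k| + k² s²`. -/
def energy (s : ℝ) (k : ℤ) (n : ℕ) : ℝ := (2 * n + 1) * |(k : ℝ)| + (k : ℝ) ^ 2 * s ^ 2

end

end Grushin

namespace Grushin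

noncomputable section

open Polynomial

/-! Separation of variables: on functions of frequency `k` in `y`, the operator acts as -d²/dx² +
k²x² + k²s², a harmonic oscillator shifted by the constant k²s². Its eigenfunctions are Hermite
functions scaled by √|k|, with eigenvalues (2n+1)|k| + k²s². Multiplied by e^{iky}, k ≠ 0, they form
an orthonormal family in L²₀(X).

The family is total. If h is orthogonal to it and h_k is a Fourier mode of h with k ≠ 0, then
e^{-|k|x²/2} h_k has vanishing moments; its decay allows its Fourier transform to be expanded in
moments, so it is zero (`ae_eq_zero_of_moments`). The mode k = 0 vanishes by the definition of
L²₀(X).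

An eigenbasis alone does not determine the spectrum: the operator with the given domain must be the
maximal diagonal operator, multiplication of coefficients by E. On the domain it acts so because the
weak identities may be tested against Gaussian modes, by cutoff (`repr_grushinS`). Conversely, E c ∈
ℓ² must put Σ c φ in the domain (`mem_domain_of_summable`). The domain asks for ∂ₓ²u and V∂_y²u
separately, so V∂_y² has to be controlled by E: in the basis it has three diagonals, with entries
bounded by E (`basisVDyy_eq`, `summable_basisVDyy`). Since only finitely many energies lie below any
bound, `spec_eq_range_of_diagonal` then gives the spectrum. -/

/-! ### Hermite polynomials -/

/-- `Heₙ' = n Heₙ₋₁`. -/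
theorem derivative_hermite_succ (n : ℕ) :
    derivative (hermite (n + 1)) = ((n : ℤ[X]) + 1) * hermite n := by
  induction n with
  | zero => simp
  | succ n ih =>
    rw [hermite_succ (n + 1), derivative_sub, derivative_mul, derivative_X, ih, derivative_mul,
      hermite_succ n]
    simp
    ring

/-- The probabilists' Hermite polynomial with real coefficients. -/
def herm (n : ℕ) : ℝ[X] := (hermite n).map (Int.castRingHom ℝ)

theorem herm_zero : herm 0 = 1 := by simp [herm]

theorem herm_succ (n : ℕ) : herm (n + 1) = X * herm n - derivative (herm n) := by
  simp [herm, hermite_succ, derivative_map]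

theorem derivative_herm_succ (n : ℕ) :
    derivative (herm (n + 1)) = ((n : ℝ[X]) + 1) * herm n := by
  simp only [herm, derivative_map, derivative_hermite_succ]
  simp

/-- The Hermite differential equation `Heₙ'' - X Heₙ' + n Heₙ = 0`. -/
theorem herm_ode (n : ℕ) :
    derivative (derivative (herm n)) - X * derivative (herm n) + (n : ℝ[X]) * herm n = 0 := by
  cases n with
  | zero => simp [herm_zero]
  | succ n =>
    rw [derivative_herm_succ, derivative_mul, herm_succ]
    simp
    ring

theorem X_mul_herm_succ (n : ℕ) :
    X * herm (n + 1) = herm (n + 2) + ((n : ℝ[X]) + 1) * herm n := by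
  rw [herm_succ (n + 1), derivative_herm_succ]; ring

theorem X_mul_herm_zero : X * herm 0 = herm 1 := by
  rw [herm_succ 0]; simp [herm_zero]

/-- Multiplication by x² couples n to n - 2, n and n + 2. The cases n = 0 and n = 1 have no lower
term and are kept apart, which avoids truncated subtraction. -/
theorem X_sq_mul_herm_zero : X ^ 2 * herm 0 = herm 2 + herm 0 := by
  rw [pow_two, mul_assoc, X_mul_herm_zero, X_mul_herm_succ]; simp

theorem X_sq_mul_herm_one : X ^ 2 * herm 1 = herm 3 + 3 * herm 1 := by
  rw [pow_two, mul_assoc, X_mul_herm_succ, mul_add, X_mul_herm_succ]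
  simp [X_mul_herm_zero]
  ring

theorem X_sq_mul_herm (n : ℕ) :
    X ^ 2 * herm (n + 2) = herm (n + 4) + (2 * n + 5 : ℝ[X]) * herm (n + 2)
      + ((n : ℝ[X]) + 2) * ((n : ℝ[X]) + 1) * herm n := by
  rw [pow_two, mul_assoc, X_mul_herm_succ, mul_add, X_mul_herm_succ, mul_left_comm,
    X_mul_herm_succ]
  push_cast
  ring

theorem natDegree_herm (n : ℕ) : (herm n).natDegree = n := by
  rw [herm, (hermite_monic n).natDegree_map, natDegree_hermite]

theorem herm_monic (n : ℕ) : (herm n).Monic := (hermite_monic n).map _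

theorem iterate_derivative_herm_self (n : ℕ) :
    derivative^[n] (herm n) = C (n.factorial : ℝ) := by
  have h : (derivative^[n] (herm n)).natDegree = 0 := by
    have := natDegree_iterate_derivative (herm n) n
    rw [natDegree_herm] at this
    omega
  rw [eq_C_of_natDegree_eq_zero h, coeff_iterate_derivative]
  have : (herm n).coeff n = 1 := by
    have := herm_monic n
    rwa [Monic, leadingCoeff, natDegree_herm] at this
  simp [this, Nat.descFactorial_self]

/-! ### Polynomials times a Gaussian -/

/-- `p(x) e^{-b x² / 2}`. -/
def gp (b : ℝ) (p : ℝ[X]) (x : ℝ) : ℝ := p.eval x * Real.exp (-(x ^ 2 * b) / 2)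

theorem gp_add (b : ℝ) (p q : ℝ[X]) (x : ℝ) : gp b (p + q) x = gp b p x + gp b q x := by
  simp [gp, add_mul]

theorem gp_sub (b : ℝ) (p q : ℝ[X]) (x : ℝ) : gp b (p - q) x = gp b p x - gp b q x := by
  simp [gp, sub_mul]

theorem gp_C_mul (b c : ℝ) (p : ℝ[X]) (x : ℝ) : gp b (C c * p) x = c * gp b p x := by
  simp [gp, mul_assoc]

/-- For a monomial, |x|^n / n! is a single term of the series of e^{|x|}. -/
theorem abs_eval_le_exp (p : ℝ[X]) : ∃ K, 0 ≤ K ∧ ∀ x : ℝ, |p.eval x| ≤ K * Real.exp |x| := by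
  induction p using Polynomial.induction_on' with
  | add p q hp hq =>
    obtain ⟨K, hK, h⟩ := hp
    obtain ⟨L, hL, h'⟩ := hq
    refine ⟨K + L, by positivity, fun x => ?_⟩
    rw [eval_add, add_mul]
    exact (abs_add_le _ _).trans (add_le_add (h x) (h' x))
  | monomial n a =>
    refine ⟨|a| * n.factorial, by positivity, fun x => ?_⟩
    have := Real.pow_div_factorial_le_exp |x| (abs_nonneg x) n
    rw [div_le_iff₀ (by positivity)] at this
    rw [eval_monomial, abs_mul, abs_pow, mul_assoc]
    gcongr
    linarith

/-- Polynomials times a Gaussian decay faster than any exponential. -/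
theorem gp_decay {b : ℝ} (hb : 0 < b) (a : ℝ) (p : ℝ[X]) :
    ∃ K, 0 ≤ K ∧ ∀ x : ℝ, Real.exp (a * |x|) * |gp b p x| ≤ K * (1 + x ^ 2)⁻¹ := by
  -- The extra factor 1 + X² supplies the integrable weight (1 + x²)⁻¹ of the conclusion.
  obtain ⟨K, hK, h⟩ := abs_eval_le_exp ((1 + X ^ 2) * p)
  refine ⟨K * Real.exp ((a + 1) ^ 2 / (2 * b)), by positivity, fun x => ?_⟩
  have h1 := h x
  rw [eval_mul, abs_mul] at h1
  have h0 : 0 < 1 + x ^ 2 := by positivity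
  have h2 : |eval x (1 + X ^ 2 : ℝ[X])| = 1 + x ^ 2 := by simp [abs_of_pos h0]
  rw [h2] at h1
  -- Completing the square: the right side is the maximum of (a+1)t - bt²/2 over real t.
  have h3 : a * |x| + |x| + -(x ^ 2 * b) / 2 ≤ (a + 1) ^ 2 / (2 * b) := by
    rw [le_div_iff₀ (by positivity), ← sq_abs x]
    nlinarith [sq_nonneg (b * |x| - (a + 1))]
  rw [← div_eq_mul_inv, le_div_iff₀ h0, gp, abs_mul, Real.abs_exp]
  calc Real.exp (a * |x|) * (|eval x p| * Real.exp (-(x ^ 2 * b) / 2)) * (1 + x ^ 2)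
      = Real.exp (a * |x|) * Real.exp (-(x ^ 2 * b) / 2) * ((1 + x ^ 2) * |eval x p|) := by ring
    _ ≤ Real.exp (a * |x|) * Real.exp (-(x ^ 2 * b) / 2) * (K * Real.exp |x|) := by gcongr
    _ = K * Real.exp (a * |x| + |x| + -(x ^ 2 * b) / 2) := by
      rw [Real.exp_add, Real.exp_add]; ring
    _ ≤ _ := by gcongr

theorem contDiff_gp (b : ℝ) (p : ℝ[X]) : ContDiff ℝ ∞ (gp b p) := by
  unfold gp
  have : ContDiff ℝ ∞ (fun x : ℝ => p.eval x) := by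
    simpa [aeval_def] using p.contDiff_aeval (𝕜 := ℝ) ∞
  fun_prop

theorem continuous_gp (b : ℝ) (p : ℝ[X]) : Continuous (gp b p) := (contDiff_gp b p).continuous

/-- The polynomial part of the derivative of `p(x) e^{-b x² / 2}`. -/
def gpD (b : ℝ) (p : ℝ[X]) : ℝ[X] := derivative p - C b * (X * p)

theorem hasDerivAt_gp (b : ℝ) (p : ℝ[X]) (x : ℝ) : HasDerivAt (gp b p) (gp b (gpD b p) x) x := by
  have h2 : HasDerivAt (fun x : ℝ => -(x ^ 2 * b) / 2) (-(2 * x * b) / 2) x := by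
    simpa using (((hasDerivAt_pow 2 x).mul_const b).neg).div_const 2
  have h3 : HasDerivAt (gp b p) _ x := (p.hasDerivAt x).mul h2.exp
  refine h3.congr_deriv ?_
  simp only [gp, gpD, eval_sub, eval_mul, eval_C, eval_X]
  ring

/-- Exponentially weighted polynomials times a Gaussian are integrable. -/
theorem integrable_exp_gp {b : ℝ} (hb : 0 < b) (a : ℝ) (p : ℝ[X]) :
    Integrable fun x : ℝ => Real.exp (a * |x|) * |gp b p x| := by
  obtain ⟨K, hK, h⟩ := gp_decay hb a p
  refine (integrable_inv_one_add_sq.const_mul K).mono' ?_ (Eventually.of_forall fun x => ?_)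
  · have := continuous_gp b p
    exact Continuous.aestronglyMeasurable (by fun_prop)
  · rw [Real.norm_of_nonneg (by positivity)]
    exact h x

/-- The function is integrable and bounded by K, so its square is at most K times itself. -/
theorem memLp_exp_gp {b : ℝ} (hb : 0 < b) (a : ℝ) (p : ℝ[X]) :
    MemLp (fun x : ℝ => Real.exp (a * |x|) * |gp b p x|) 2 := by
  have hc : Continuous fun x : ℝ => Real.exp (a * |x|) * |gp b p x| := by
    have := continuous_gp b p
    fun_prop
  rw [memLp_two_iff_integrable_sq hc.aestronglyMeasurable]
  obtain ⟨K, hK, h⟩ := gp_decay hb a p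
  refine ((integrable_exp_gp hb a p).const_mul K).mono' (hc.pow 2).aestronglyMeasurable
    (Eventually.of_forall fun x => ?_)
  rw [Real.norm_of_nonneg (by positivity), pow_two]
  have h1 : (1 + x ^ 2)⁻¹ ≤ 1 := inv_le_one_of_one_le₀ (by nlinarith [sq_nonneg x])
  have h2 := (h x).trans (mul_le_of_le_one_right hK h1)
  gcongr

theorem integrable_gp {b : ℝ} (hb : 0 < b) (p : ℝ[X]) : Integrable (gp b p) := by
  refine (integrable_exp_gp hb 0 p).mono' (continuous_gp b p).aestronglyMeasurable
    (Eventually.of_forall fun x => ?_)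
  rw [zero_mul, Real.exp_zero, one_mul, Real.norm_eq_abs]

theorem integral_gp_gpD {b : ℝ} (hb : 0 < b) (p : ℝ[X]) : ∫ x, gp b (gpD b p) x = 0 :=
  integral_eq_zero_of_hasDerivAt_of_integrable (fun x => hasDerivAt_gp b p x)
    (integrable_gp hb _) (integrable_gp hb _)

/-- For the weight e^{-x²/2} the adjoint of d/dx is X - d/dx, which raises He_n to He_{n+1}.
Integrating by parts n times therefore moves all of He_n onto q as derivatives. Orthogonality
follows by degree, and the norm from the n-th derivative of a monic polynomial. -/
theorem integral_gp_herm_mul (n : ℕ) (q : ℝ[X]) :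
    ∫ x, gp 1 (herm n * q) x = ∫ x, gp 1 (derivative^[n] q) x := by
  induction n generalizing q with
  | zero => simp [herm_zero]
  | succ n ih =>
    have e : herm (n + 1) * q = herm n * derivative q - gpD 1 (herm n * q) := by
      rw [herm_succ, gpD, derivative_mul]
      simp
      ring
    simp_rw [e, gp_sub]
    rw [integral_sub (integrable_gp one_pos _) (integrable_gp one_pos _),
      integral_gp_gpD one_pos, sub_zero, ih, Function.iterate_succ_apply]

theorem integral_gp_herm_mul_herm (m n : ℕ) :
    ∫ x, gp 1 (herm m * herm n) x
      = if m = n then (n.factorial : ℝ) * Real.sqrt (2 * Real.pi) else 0 := by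
  have key : ∀ m n : ℕ, n < m → ∫ x, gp 1 (herm m * herm n) x = 0 := by
    intro m n h
    rw [integral_gp_herm_mul, iterate_derivative_eq_zero (by rwa [natDegree_herm])]
    simp [gp]
  rcases lt_trichotomy m n with h | h | h
  · rw [if_neg h.ne, mul_comm, key n m h]
  · subst h
    rw [if_pos rfl, integral_gp_herm_mul, iterate_derivative_herm_self]
    simp only [gp, eval_C]
    rw [integral_const_mul]
    congr 1
    have := integral_gaussian (1 / 2)
    rw [show Real.pi / (1 / 2) = 2 * Real.pi by ring] at this
    rw [← this]
    congr 1
    ext x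
    congr 1
    ring
  · rw [if_neg h.ne', key m n h]

/-! ### Integration by parts on the cylinder -/

theorem IsTest.hasDerivAt_dx {φ : Cyl → ℂ} (hφ : IsTest φ) (x : ℝ) (y : Circ) :
    HasDerivAt (fun t : ℝ => φ (t, y)) (Grushin.dx φ (x, y)) x := by
  obtain ⟨y, rfl⟩ := QuotientAddGroup.mk_surjective y
  have h : Differentiable ℝ (fun t : ℝ => φ (t, ((y : ℝ) : Circ))) :=
    (hφ.smooth.differentiable (by simp)).comp
      (differentiable_id.prodMk (differentiable_const y))
  exact (h x).hasDerivAt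

theorem IsTest.hasDerivAt_dy {φ : Cyl → ℂ} (hφ : IsTest φ) (x y : ℝ) :
    HasDerivAt (fun t : ℝ => φ (x, (t : Circ))) (Grushin.dy φ (x, (y : Circ))) y := by
  rw [hφ.dy_lift]
  have h := ((hφ.smooth.differentiable (by simp)) (x, y)).hasFDerivAt
  have h2 : HasDerivAt (fun t : ℝ => (x, t)) ((0 : ℝ), (1 : ℝ)) y :=
    (hasDerivAt_const y x).prodMk (hasDerivAt_id y)
  exact h.comp_hasDerivAt y h2

theorem IsTest.integrable_slice {φ : Cyl → ℂ} (hφ : IsTest φ) (y : Circ) :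
    Integrable fun x : ℝ => φ (x, y) := by
  have hc : Continuous fun x : ℝ => φ (x, y) := hφ.continuous.comp (by fun_prop)
  refine hc.integrable_of_hasCompactSupport ?_
  refine HasCompactSupport.intro (K := Prod.fst '' tsupport φ)
    (hφ.compact.isCompact.image continuous_fst) fun x hx => ?_
  exact image_eq_zero_of_notMem_tsupport fun h => hx ⟨_, h, rfl⟩

theorem IsTest.integrable {φ : Cyl → ℂ} (hφ : IsTest φ) : Integrable φ :=
  hφ.continuous.integrable_of_hasCompactSupport hφ.compact

theorem IsTest.integral_dx {φ : Cyl → ℂ} (hφ : IsTest φ) : ∫ p, Grushin.dx φ p = 0 := by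
  have hi : Integrable (Grushin.dx φ) ((volume : Measure ℝ).prod (volume : Measure Circ)) :=
    hφ.dx.integrable
  refine (integral_prod_symm _ hi).trans ?_
  refine integral_eq_zero_of_ae (Eventually.of_forall fun y => ?_)
  exact integral_eq_zero_of_hasDerivAt_of_integrable (fun x => hφ.hasDerivAt_dx x y)
    (hφ.dx.integrable_slice y) (hφ.integrable_slice y)

theorem IsTest.integral_dy {φ : Cyl → ℂ} (hφ : IsTest φ) : ∫ p, Grushin.dy φ p = 0 := by
  have hi : Integrable (Grushin.dy φ) ((volume : Measure ℝ).prod (volume : Measure Circ)) :=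
    hφ.dy.integrable
  refine (integral_prod _ hi).trans ?_
  refine integral_eq_zero_of_ae (Eventually.of_forall fun x => ?_)
  have hc : Continuous fun t : ℝ => Grushin.dy φ (x, (t : Circ)) :=
    hφ.dy.continuous.comp (continuous_const.prodMk (AddCircle.continuous_mk' _))
  have := AddCircle.intervalIntegral_preimage (2 * Real.pi) 0 fun y => Grushin.dy φ (x, y)
  simp only [Pi.zero_apply]
  rw [← this, intervalIntegral.integral_eq_sub_of_hasDerivAt
    (fun t _ => hφ.hasDerivAt_dy x t) (hc.intervalIntegrable _ _)]
  rw [zero_add, AddCircle.coe_period, AddCircle.coe_zero, sub_self]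

/-! ### Gaussian modes -/

/-- `p(x) e^{-b x² / 2} e^{iky}`. -/
def mode (b : ℝ) (k : ℤ) (p : ℝ[X]) (q : Cyl) : ℂ := (gp b p q.1 : ℂ) * fourier k q.2

theorem continuous_mode (b : ℝ) (k : ℤ) (p : ℝ[X]) : Continuous (mode b k p) := by
  have := continuous_gp b p
  unfold mode
  fun_prop

theorem norm_fourier (k : ℤ) (y : Circ) : ‖fourier k y‖ = 1 := by
  rw [fourier_apply]; exact Circle.norm_coe _

theorem norm_mode (b : ℝ) (k : ℤ) (p : ℝ[X]) (q : Cyl) : ‖mode b k p q‖ = |gp b p q.1| := by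
  rw [mode, norm_mul, norm_fourier, mul_one, Complex.norm_real, Real.norm_eq_abs]

theorem memLp_exp_mode {b : ℝ} (hb : 0 < b) (a : ℝ) (k : ℤ) (p : ℝ[X]) :
    MemLp (fun q : Cyl => (Real.exp (a * |q.1|) : ℂ) * mode b k p q) 2 := by
  have hc : Continuous fun q : Cyl => (Real.exp (a * |q.1|) : ℂ) * mode b k p q := by
    have := continuous_mode b k p
    fun_prop
  rw [memLp_two_iff_integrable_sq_norm hc.aestronglyMeasurable]
  have h1 := ((memLp_exp_gp hb a p).integrable_sq).mul_prod
    (integrable_const (1 : ℝ) (μ := (volume : Measure Circ)))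
  refine h1.congr (Eventually.of_forall fun q => ?_)
  simp only [norm_mul, norm_mode, Complex.norm_real, Real.norm_eq_abs, Real.abs_exp, mul_one]

theorem memLp_mode {b : ℝ} (hb : 0 < b) (k : ℤ) (p : ℝ[X]) : MemLp (mode b k p) 2 := by
  simpa using memLp_exp_mode hb 0 k p

/-- `p(x) e^{-b x² / 2} e^{iky}` as an element of `L²(X)`. -/
def modeL {b : ℝ} (hb : 0 < b) (k : ℤ) (p : ℝ[X]) : L2X := (memLp_mode hb k p).toLp _

theorem coeFn_modeL {b : ℝ} (hb : 0 < b) (k : ℤ) (p : ℝ[X]) :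
    modeL hb k p =ᵐ[volume] mode b k p := MemLp.coeFn_toLp _

theorem modeL_add {b : ℝ} (hb : 0 < b) (k : ℤ) (p q : ℝ[X]) :
    modeL hb k (p + q) = modeL hb k p + modeL hb k q := by
  rw [modeL, modeL, modeL, ← MemLp.toLp_add]
  congr 1
  ext x
  simp [mode, gp_add, add_mul]

theorem modeL_C_mul {b : ℝ} (hb : 0 < b) (k : ℤ) (c : ℝ) (p : ℝ[X]) :
    modeL hb k (C c * p) = (c : ℂ) • modeL hb k p := by
  rw [modeL, modeL, ← MemLp.toLp_const_smul]
  congr 1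
  ext x
  simp [mode, gp_C_mul, mul_assoc]

theorem integral_modeL_mul {b : ℝ} (hb : 0 < b) (k : ℤ) (p : ℝ[X]) (ψ : Cyl → ℂ) :
    ∫ q, modeL hb k p q * ψ q = ∫ q, mode b k p q * ψ q := by
  refine integral_congr_ae ?_
  filter_upwards [coeFn_modeL hb k p] with q hq
  rw [hq]

theorem isTest_mode_mul {φ : Cyl → ℂ} (hφ : IsTest φ) (b : ℝ) (k : ℤ) (p : ℝ[X]) :
    IsTest fun q => mode b k p q * φ q := by
  refine ⟨?_, hφ.compact.mul_left⟩
  simp only [mode, fourier_mk]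
  have h1 : ContDiff ℝ ∞ (fun q : ℝ × ℝ => ((gp b p q.1 : ℝ) : ℂ)) :=
    Complex.ofRealCLM.contDiff.comp ((contDiff_gp b p).comp contDiff_fst)
  have h2 : ContDiff ℝ ∞ (fun q : ℝ × ℝ => ((q.2 : ℝ) : ℂ)) :=
    Complex.ofRealCLM.contDiff.comp contDiff_snd
  exact (h1.mul (contDiff_const.mul h2).cexp).mul hφ.smooth

theorem hasDerivAt_fourier_mk (k : ℤ) (y : ℝ) :
    HasDerivAt (fun t : ℝ => fourier k (t : Circ)) (Complex.I * k * fourier k (y : Circ)) y := by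
  simp only [fourier_mk]
  have h : HasDerivAt (fun t : ℝ => Complex.I * k * (t : ℂ)) (Complex.I * k) y := by
    simpa using (Complex.ofRealCLM.hasDerivAt (x := y)).const_mul (Complex.I * k)
  convert h.cexp using 1
  ring

theorem dy_eq_of_hasDerivAt {φ : Cyl → ℂ} {x y : ℝ} {c : ℂ}
    (h : HasDerivAt (fun t : ℝ => φ (x, (t : Circ))) c y) : dy φ (x, (y : Circ)) = c := by
  have h' : HasDerivAt (fun t : ℝ => φ (x, (t : Circ))) c (y + 0) := by simpa using h
  have := h'.comp_const_add y 0
  simpa [dy] using this.deriv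

/-- The product of a mode with a test function is again a test function, so its derivative has
integral zero; the Leibniz rule splits that integral. -/
theorem integral_mode_mul_dx {φ : Cyl → ℂ} (hφ : IsTest φ) (b : ℝ) (k : ℤ) (p : ℝ[X]) :
    ∫ q, mode b k p q * dx φ q = -∫ q, mode b k (gpD b p) q * φ q := by
  rw [eq_neg_iff_add_eq_zero, ← integral_add (isTest_mode_mul hφ.dx b k p).integrable
    (isTest_mode_mul hφ b k _).integrable, ← (isTest_mode_mul hφ b k p).integral_dx]
  refine integral_congr_ae (Eventually.of_forall fun q => ?_)
  have h1 := ((hasDerivAt_gp b p q.1).ofReal_comp.mul_const (fourier k q.2)).mul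
    (hφ.hasDerivAt_dx q.1 q.2)
  exact (add_comm _ _).trans h1.deriv.symm

theorem integral_mode_mul_dy {φ : Cyl → ℂ} (hφ : IsTest φ) (b : ℝ) (k : ℤ) (p : ℝ[X]) :
    ∫ q, mode b k p q * dy φ q = -(Complex.I * k) * ∫ q, mode b k p q * φ q := by
  rw [neg_mul, eq_neg_iff_add_eq_zero, ← integral_const_mul,
    ← integral_add (isTest_mode_mul hφ.dy b k p).integrable
    ((isTest_mode_mul hφ b k _).integrable.const_mul _), ← (isTest_mode_mul hφ b k p).integral_dy]
  refine integral_congr_ae (Eventually.of_forall fun ⟨x, y⟩ => ?_)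
  obtain ⟨y, rfl⟩ := QuotientAddGroup.mk_surjective y
  have h1 := ((hasDerivAt_fourier_mk k y).const_mul (gp b p x : ℂ)).mul (hφ.hasDerivAt_dy x y)
  refine Eq.trans ?_ (dy_eq_of_hasDerivAt h1).symm
  simp only [mode]
  change _ * dy φ (x, (y : Circ)) + _ = _ + _ * dy φ (x, (y : Circ))
  ring

theorem isWeakDxx_modeL {b : ℝ} (hb : 0 < b) (k : ℤ) (p : ℝ[X]) :
    IsWeakDxx (modeL hb k p) (modeL hb k (gpD b (gpD b p))) := fun φ hφ => by
  rw [integral_modeL_mul, integral_modeL_mul, integral_mode_mul_dx hφ.dx,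
    integral_mode_mul_dx hφ, neg_neg]

/-- The potential `V(x) = x² + s²`. -/
def potential (s : ℝ) : C(ℝ, ℝ) := ⟨fun x => x ^ 2 + s ^ 2, by fun_prop⟩

/-- The potential `V(x) = x² + s²` as a polynomial. -/
def potentialPoly (s : ℝ) : ℝ[X] := X ^ 2 + C (s ^ 2)

theorem gp_potentialPoly_mul (s b : ℝ) (p : ℝ[X]) (x : ℝ) :
    gp b (potentialPoly s * p) x = potential s x * gp b p x := by
  simp [gp, potential, potentialPoly, mul_assoc]

theorem isWeakVDyy_modeL (s : ℝ) {b : ℝ} (hb : 0 < b) (k : ℤ) (p : ℝ[X]) :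
    IsWeakVDyy (potential s) (modeL hb k p)
      (((-(k : ℝ) ^ 2 : ℝ) : ℂ) • modeL hb k (potentialPoly s * p)) := fun φ hφ => by
  rw [integral_smul_mul, integral_modeL_mul, integral_modeL_mul]
  -- V depends only on x and is polynomial, so it can be absorbed into the mode before integrating
  -- by parts in y. Each of the two integrations then contributes -ik.
  have e : (fun q => mode b k p q * ((potential s q.1 : ℂ) * dy (dy φ) q))
      = fun q => mode b k (potentialPoly s * p) q * dy (dy φ) q := by
    funext q
    simp only [mode, gp_potentialPoly_mul]
    push_cast
    ring
  rw [e, integral_mode_mul_dy hφ.dy, integral_mode_mul_dy hφ, ← mul_assoc]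
  congr 1
  push_cast
  linear_combination (k : ℂ) ^ 2 * Complex.I_sq

/-! ### Testing against Gaussian modes -/

theorem integrable_mul_mode (u : L2X) {b : ℝ} (hb : 0 < b) (k : ℤ) (p : ℝ[X]) :
    Integrable fun q => u q * mode b k p q :=
  (Lp.memLp u).integrable_mul (q := 2) (memLp_mode hb k p)

/-- Dominated convergence for bounded multipliers m_n converging pointwise to a constant: c = 1 for
the cutoffs themselves, c = 0 for the terms in which a derivative has fallen on a cutoff. -/
theorem tendsto_integral_cutoff (u : L2X) {b : ℝ} (hb : 0 < b) (k : ℤ) (p : ℝ[X])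
    {m : ℕ → ℝ → ℝ} {c M : ℝ} (hm : ∀ n, Continuous (m n)) (hM : ∀ n x, |m n x| ≤ M)
    (hl : ∀ x, Tendsto (fun n => m n x) atTop (𝓝 c)) :
    Tendsto (fun n => ∫ q : Cyl, u q * ((m n q.1 * gp b p q.1 : ℝ) * fourier k q.2)) atTop
      (𝓝 (c * ∫ q, u q * mode b k p q)) := by
  rw [← integral_const_mul]
  refine tendsto_integral_of_dominated_convergence (fun q => M * ‖u q * mode b k p q‖) ?_
    ((integrable_mul_mode u hb k p).norm.const_mul M) ?_ ?_
  · intro n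
    refine (Lp.aestronglyMeasurable u).mul (Continuous.aestronglyMeasurable ?_)
    have := hm n
    have := continuous_gp b p
    fun_prop
  · intro n
    refine Eventually.of_forall fun q => ?_
    have e : u q * ((m n q.1 * gp b p q.1 : ℝ) * fourier k q.2)
        = (m n q.1 : ℂ) * (u q * mode b k p q) := by
      simp only [mode]; push_cast; ring
    rw [e, norm_mul, Complex.norm_real, Real.norm_eq_abs]
    exact mul_le_mul_of_nonneg_right (hM n q.1) (norm_nonneg _)
  · refine Eventually.of_forall fun q => ?_
    have e : ∀ n, u q * ((m n q.1 * gp b p q.1 : ℝ) * fourier k q.2)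
        = (m n q.1 : ℂ) * (u q * mode b k p q) := fun n => by
      simp only [mode]; push_cast; ring
    simp only [e]
    exact ((Complex.continuous_ofReal.tendsto c).comp (hl q.1)).mul_const _

theorem dx_mul_fourier {a a' : ℝ → ℝ} (ha : ∀ x, HasDerivAt a (a' x) x) (k : ℤ) :
    dx (fun p : Cyl => (a p.1 : ℂ) * fourier k p.2)
      = fun p : Cyl => (a' p.1 : ℂ) * fourier k p.2 :=
  funext fun p => HasDerivAt.deriv ((ha p.1).ofReal_comp.mul_const (fourier k p.2))

theorem dy_mul_fourier (a : ℝ → ℂ) (k : ℤ) :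
    dy (fun p : Cyl => a p.1 * fourier k p.2)
      = fun p : Cyl => (Complex.I * k * a p.1) * fourier k p.2 := by
  funext ⟨x, y⟩
  obtain ⟨y, rfl⟩ := QuotientAddGroup.mk_surjective y
  refine (dy_eq_of_hasDerivAt ((hasDerivAt_fourier_mk k y).const_mul (a x))).trans ?_
  change _ = Complex.I * k * a x * fourier k (y : Circ)
  ring

/-! ### Scaled cutoffs χ(εx) and the passage from test functions to Gaussian modes. -/

theorem exists_cutoff : ∃ χ : ℝ → ℝ, ContDiff ℝ ∞ χ ∧ HasCompactSupport χ ∧ χ 0 = 1 := by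
  let f : ContDiffBump (0 : ℝ) := ⟨1, 2, by norm_num, by norm_num⟩
  exact ⟨f, f.contDiff, f.hasCompactSupport, f.one_of_mem_closedBall (by simp [f.rIn_pos.le])⟩

theorem exists_abs_le {χ : ℝ → ℝ} (hc : Continuous χ) (hs : HasCompactSupport χ) :
    ∃ M, ∀ x, |χ x| ≤ M := hc.bounded_above_of_compact_support hs

theorem hasCompactSupport_comp_mul {χ : ℝ → ℝ} (hs : HasCompactSupport χ) {ε : ℝ} (hε : ε ≠ 0) :
    HasCompactSupport fun x => χ (ε * x) := by
  exact hs.comp_homeomorph (Homeomorph.mulLeft₀ ε hε)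

theorem tendsto_cutoff {χ : ℝ → ℝ} (hc : Continuous χ) (x : ℝ) :
    Tendsto (fun n : ℕ => χ (1 / ((n : ℝ) + 1) * x)) atTop (𝓝 (χ 0)) := by
  have h := (tendsto_one_div_add_atTop_nhds_zero_nat (𝕜 := ℝ)).mul_const x
  rw [zero_mul] at h
  exact (hc.tendsto 0).comp h

theorem tendsto_eps_mul {χ : ℝ → ℝ} (hc : Continuous χ) (j : ℕ) (hj : j ≠ 0) (x : ℝ) :
    Tendsto (fun n : ℕ => (1 / ((n : ℝ) + 1)) ^ j * χ (1 / ((n : ℝ) + 1) * x)) atTop (𝓝 0) := by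
  have h := ((tendsto_one_div_add_atTop_nhds_zero_nat (𝕜 := ℝ)).pow j).mul (tendsto_cutoff hc x)
  simpa [hj] using h

theorem abs_eps_mul_le {χ : ℝ → ℝ} {M : ℝ} (hM : ∀ x, |χ x| ≤ M) (j n : ℕ) (x : ℝ) :
    |(1 / ((n : ℝ) + 1)) ^ j * χ (1 / ((n : ℝ) + 1) * x)| ≤ M := by
  rw [abs_mul, abs_of_nonneg (by positivity)]
  have h1 : (1 / ((n : ℝ) + 1)) ^ j ≤ 1 := by
    refine pow_le_one₀ (by positivity) ?_
    rw [div_le_one (by positivity)]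
    linarith [(Nat.cast_nonneg n : (0 : ℝ) ≤ n)]
  exact (mul_le_of_le_one_left (abs_nonneg _) h1).trans (hM _)

theorem integrable_mul_compact_gp (u : L2X) {a : ℝ → ℝ} (ha : Continuous a)
    (has : HasCompactSupport a) (b : ℝ) (k : ℤ) (p : ℝ[X]) :
    Integrable fun q : Cyl => u q * ((a q.1 * gp b p q.1 : ℝ) * fourier k q.2) := by
  have hc : Continuous fun q : Cyl => ((a q.1 * gp b p q.1 : ℝ) : ℂ) * fourier k q.2 := by
    have := continuous_gp b p
    fun_prop
  refine integrable_mul u hc (HasCompactSupport.intro (K := tsupport a ×ˢ univ)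
    (has.isCompact.prod isCompact_univ) fun q hq => ?_)
  have : q.1 ∉ tsupport a := fun h => hq ⟨h, mem_univ _⟩
  simp [image_eq_zero_of_notMem_tsupport this]

theorem hasCompactSupport_mul_comp_mul {χ : ℝ → ℝ} (hs : HasCompactSupport χ) {ε : ℝ} (hε : ε ≠ 0)
    (c : ℝ) : HasCompactSupport fun x => c * χ (ε * x) := by
  have h := hasCompactSupport_comp_mul hs hε
  exact h.mul_left (f := fun _ => c)

theorem hasDerivAt_comp_mul {χ : ℝ → ℝ} (hχ : Differentiable ℝ χ) (ε x : ℝ) :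
    HasDerivAt (fun x => χ (ε * x)) (ε * deriv χ (ε * x)) x :=
  ((hχ (ε * x)).hasDerivAt.comp x ((hasDerivAt_id x).const_mul ε)).congr_deriv (by ring)

/-- The weak identity tested on χ(εx) times a mode, expanded by Leibniz: every derivative on the
cutoff costs a factor ε. The power `ε ^ 1` is left unsimplified to fit `tendsto_eps_mul` and
`abs_eps_mul_le`. -/
theorem IsWeakDxx.integral_cutoff_mode {u g : L2X} (h : IsWeakDxx u g) (b : ℝ) (k : ℤ)
    (p : ℝ[X]) {χ : ℝ → ℝ} (hχ : ContDiff ℝ ∞ χ) (hs : HasCompactSupport χ) {ε : ℝ} (hε : ε ≠ 0) :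
    (∫ q : Cyl, u q * ((ε ^ 2 * deriv (deriv χ) (ε * q.1) * gp b p q.1 : ℝ) * fourier k q.2))
      + 2 * (∫ q : Cyl, u q * ((ε ^ 1 * deriv χ (ε * q.1) * gp b (gpD b p) q.1 : ℝ)
        * fourier k q.2))
      + (∫ q : Cyl, u q * ((χ (ε * q.1) * gp b (gpD b (gpD b p)) q.1 : ℝ) * fourier k q.2))
      = ∫ q : Cyl, g q * ((χ (ε * q.1) * gp b p q.1 : ℝ) * fourier k q.2) := by
  have hχ1 : ContDiff ℝ ∞ (deriv χ) := by simpa using hχ.iterate_deriv 1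
  have hχ2 : ContDiff ℝ ∞ (deriv (deriv χ)) := by simpa using hχ1.iterate_deriv 1
  have c0 := hχ.continuous
  have c1 := hχ1.continuous
  have c2 := hχ2.continuous
  have d0 := hasDerivAt_comp_mul (hχ.differentiable (by simp)) ε
  have d1 := hasDerivAt_comp_mul (hχ1.differentiable (by simp)) ε
  have e0 : ∀ x, HasDerivAt (fun x => χ (ε * x) * gp b p x)
      (ε * deriv χ (ε * x) * gp b p x + χ (ε * x) * gp b (gpD b p) x) x :=
    fun x => (d0 x).mul (hasDerivAt_gp b p x)
  have e1 : ∀ x, HasDerivAt (fun x => ε * deriv χ (ε * x) * gp b p x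
      + χ (ε * x) * gp b (gpD b p) x)
      (ε * (ε * deriv (deriv χ) (ε * x)) * gp b p x + ε * deriv χ (ε * x) * gp b (gpD b p) x
        + (ε * deriv χ (ε * x) * gp b (gpD b p) x
          + χ (ε * x) * gp b (gpD b (gpD b p)) x)) x :=
    fun x => (((d1 x).const_mul ε).mul (hasDerivAt_gp b p x)).add
      ((d0 x).mul (hasDerivAt_gp b (gpD b p) x))
  have hT := isTest_mul_fourier (a := fun x => χ (ε * x) * gp b p x)
    ((hχ.comp (contDiff_const.mul contDiff_id)).mul (contDiff_gp b p))
    (hasCompactSupport_comp_mul hs hε).mul_right k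
  have := h _ hT
  rw [dx_mul_fourier e0, dx_mul_fourier e1] at this
  refine Eq.trans ?_ this
  have I2 := integrable_mul_compact_gp u (a := fun x => ε ^ 2 * deriv (deriv χ) (ε * x))
    (by fun_prop) (hasCompactSupport_mul_comp_mul hs.deriv.deriv hε _) b k p
  have I1 := (integrable_mul_compact_gp u (a := fun x => ε ^ 1 * deriv χ (ε * x))
    (by fun_prop) (hasCompactSupport_mul_comp_mul hs.deriv hε _) b k (gpD b p)).const_mul 2
  have I0 := integrable_mul_compact_gp u (a := fun x => χ (ε * x)) (by fun_prop)
    (hasCompactSupport_comp_mul hs hε) b k (gpD b (gpD b p))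
  rw [← integral_const_mul, ← integral_add I2 I1]
  refine (integral_add (I2.add I1) I0).symm.trans ?_
  refine integral_congr_ae (Eventually.of_forall fun q => ?_)
  simp only [Pi.add_apply]
  push_cast
  ring

/-- Weak second derivatives in `x` may be tested against Gaussian modes. -/
theorem IsWeakDxx.integral_mode {u g : L2X} (h : IsWeakDxx u g) {b : ℝ} (hb : 0 < b) (k : ℤ)
    (p : ℝ[X]) :
    ∫ q, u q * mode b k (gpD b (gpD b p)) q = ∫ q, g q * mode b k p q := by
  obtain ⟨χ, hχ, hs, h0⟩ := exists_cutoff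
  have hχ1 : ContDiff ℝ ∞ (deriv χ) := by simpa using hχ.iterate_deriv 1
  have hχ2 : ContDiff ℝ ∞ (deriv (deriv χ)) := by simpa using hχ1.iterate_deriv 1
  have c0 := hχ.continuous
  have c1 := hχ1.continuous
  have c2 := hχ2.continuous
  obtain ⟨M, hM⟩ := exists_abs_le c0 hs
  obtain ⟨M1, hM1⟩ := exists_abs_le c1 hs.deriv
  obtain ⟨M2, hM2⟩ := exists_abs_le c2 hs.deriv.deriv
  have l0 : ∀ x, Tendsto (fun n : ℕ => χ (1 / ((n : ℝ) + 1) * x)) atTop (𝓝 1) :=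
    fun x => h0 ▸ tendsto_cutoff c0 x
  have L := tendsto_integral_cutoff g hb k p (fun n => by fun_prop) (fun n x => hM _) l0
  have R0 := tendsto_integral_cutoff u hb k (gpD b (gpD b p)) (fun n => by fun_prop)
    (fun n x => hM _) l0
  have R1 := tendsto_integral_cutoff u hb k (gpD b p) (fun n => by fun_prop)
    (fun n x => abs_eps_mul_le hM1 1 n x) (fun x => tendsto_eps_mul c1 1 one_ne_zero x)
  have R2 := tendsto_integral_cutoff u hb k p (fun n => by fun_prop)
    (fun n x => abs_eps_mul_le hM2 2 n x) (fun x => tendsto_eps_mul c2 2 two_ne_zero x)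
  -- The terms carrying ε and ε² tend to zero; only the one with both derivatives on the mode
  -- survives.
  have R := (R2.add (R1.const_mul 2)).add R0
  rw [Complex.ofReal_one, one_mul] at L
  rw [Complex.ofReal_one, one_mul, Complex.ofReal_zero, zero_mul, zero_mul, mul_zero, zero_add,
    zero_add] at R
  exact tendsto_nhds_unique R (L.congr fun n =>
    (h.integral_cutoff_mode b k p hχ hs (ε := 1 / ((n : ℝ) + 1)) (by positivity)).symm)

/-- The weak `V ∂_y²` may be tested against Gaussian modes. -/
theorem IsWeakVDyy.integral_mode {s : ℝ} {u g : L2X} (h : IsWeakVDyy (potential s) u g) {b : ℝ}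
    (hb : 0 < b) (k : ℤ) (p : ℝ[X]) :
    -(k : ℂ) ^ 2 * ∫ q, u q * mode b k (potentialPoly s * p) q = ∫ q, g q * mode b k p q := by
  obtain ⟨χ, hχ, hs, h0⟩ := exists_cutoff
  obtain ⟨M, hM⟩ := exists_abs_le hχ.continuous hs
  set ε : ℕ → ℝ := fun n => 1 / ((n : ℝ) + 1) with hε
  have hε0 : ∀ n, ε n ≠ 0 := fun n => by simp only [hε]; positivity
  have L := tendsto_integral_cutoff g hb k p (m := fun n x => χ (ε n * x)) (c := 1) (M := M)
    (fun n => by have := hχ.continuous; fun_prop) (fun n x => hM _)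
    (fun x => h0 ▸ tendsto_cutoff hχ.continuous x)
  have R := (tendsto_integral_cutoff u hb k (potentialPoly s * p) (m := fun n x => χ (ε n * x))
    (c := 1) (M := M) (fun n => by have := hχ.continuous; fun_prop) (fun n x => hM _)
    (fun x => h0 ▸ tendsto_cutoff hχ.continuous x)).const_mul (-(k : ℂ) ^ 2)
  simp only [Complex.ofReal_one, one_mul] at L R
  refine tendsto_nhds_unique R (L.congr fun n => ?_)
  have hT := isTest_mul_fourier (a := fun x => χ (ε n * x) * gp b p x)
    ((hχ.comp (contDiff_const.mul contDiff_id)).mul (contDiff_gp b p))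
    (hasCompactSupport_comp_mul hs (hε0 n)).mul_right k
  rw [← h _ hT, ← integral_const_mul]
  refine integral_congr_ae (Eventually.of_forall fun q => ?_)
  -- The cutoff does not depend on y, so ∂_y² acts as multiplication by (ik)² and leaves no error
  -- term.
  have e1 := dy_mul_fourier (fun x => ((χ (ε n * x) * gp b p x : ℝ) : ℂ)) k
  have e2 := dy_mul_fourier
    (fun x => Complex.I * k * ((χ (ε n * x) * gp b p x : ℝ) : ℂ)) k
  simp only [e1, e2, gp_potentialPoly_mul]
  push_cast
  linear_combination (u q * (potential s q.1 : ℂ) * (k : ℂ) ^ 2 * (χ (ε n * q.1) : ℂ)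
    * (gp b p q.1 : ℂ) * fourier k q.2) * Complex.I_sq

/-! ### Completeness -/

open scoped FourierTransform in
/-- An integrable function on the line with vanishing Fourier transform is zero. -/
theorem ae_eq_zero_of_fourier_eq_zero {g : ℝ → ℂ} (hg : Integrable g) (h : ∀ w, 𝓕 g w = 0) :
    g =ᵐ[volume] 0 := by
  refine ae_eq_zero_of_integral_contDiff_smul_eq_zero hg.locallyIntegrable fun a ha hs => ?_
  have ha' : ContDiff ℝ ∞ fun x => (a x : ℂ) := Complex.ofRealCLM.contDiff.comp ha
  have hs' : HasCompactSupport fun x => (a x : ℂ) := hs.comp_left Complex.ofReal_zero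
  set A : SchwartzMap ℝ ℂ := hs'.toSchwartzMap ha'
  -- The Fourier transform can be moved across the pairing: a test function is the transform of a
  -- Schwartz function, so its integral against g becomes one against the transform of g, which is
  -- zero.
  have e := VectorFourier.integral_fourierIntegral_smul_eq_flip (L := innerₗ ℝ)
    (μ := volume) (ν := volume) (f := (𝓕⁻ A : SchwartzMap ℝ ℂ)) (g := g)
    Real.continuous_fourierChar continuous_inner (SchwartzMap.integrable _) hg
  have e1 : ∀ x, VectorFourier.fourierIntegral Real.fourierChar volume (innerₗ ℝ)
      (𝓕⁻ A : SchwartzMap ℝ ℂ) x = (a x : ℂ) := fun x => by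
    have : (𝓕 (𝓕⁻ A) : SchwartzMap ℝ ℂ) x = A x := by rw [FourierTransform.fourier_fourierInv_eq]
    exact this
  have e2 : ∀ x, VectorFourier.fourierIntegral Real.fourierChar volume (innerₗ ℝ).flip g x = 0 :=
    fun x => by rw [flip_innerₗ]; exact h x
  simp only [e1, e2, smul_zero, integral_zero] at e
  rw [← e]
  rfl

open scoped FourierTransform in
/-- A function with exponential decay all of whose moments vanish is zero. -/
theorem ae_eq_zero_of_moments {g : ℝ → ℂ}
    (hg : ∀ a : ℝ, Integrable fun x : ℝ => (Real.exp (a * |x|) : ℂ) * g x)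
    (h : ∀ n : ℕ, ∫ x : ℝ, (x : ℂ) ^ n * g x = 0) : g =ᵐ[volume] 0 := by
  have hg0 : Integrable g := by simpa using hg 0
  refine ae_eq_zero_of_fourier_eq_zero hg0 fun w => ?_
  obtain ⟨c, hc⟩ : ∃ c : ℂ, c = -2 * Real.pi * w * Complex.I := ⟨_, rfl⟩
  -- The Fourier kernel e^{cx}, c = -2πiw, is expanded in its power series and integrated term by
  -- term. The partial sums are dominated by e^{‖c‖|x|} |g|, which is where exponential
  -- integrability enters.
  have key : HasSum (fun n : ℕ => ∫ x : ℝ, (c * x) ^ n / n.factorial * g x)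
      (∫ x : ℝ, Complex.exp (c * x) * g x) := by
    have hb : ∀ x : ℝ, HasSum (fun n : ℕ => (‖c‖ * |x|) ^ n / n.factorial * ‖g x‖)
        (Real.exp (‖c‖ * |x|) * ‖g x‖) := fun x => by
      have := NormedSpace.expSeries_div_hasSum_exp (‖c‖ * |x|)
      rw [← Real.exp_eq_exp_ℝ] at this
      exact this.mul_right _
    refine hasSum_integral_of_dominated_convergence
      (fun n x => (‖c‖ * |x|) ^ n / n.factorial * ‖g x‖) ?_ ?_ ?_ ?_ ?_
    · intro n
      exact (Continuous.aestronglyMeasurable (by fun_prop)).mul hg0.aestronglyMeasurable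
    · intro n
      refine Eventually.of_forall fun x => ?_
      simp
    · exact Eventually.of_forall fun x => (hb x).summable
    · have : (fun x : ℝ => ∑' n : ℕ, (‖c‖ * |x|) ^ n / n.factorial * ‖g x‖)
          = fun x => ‖(Real.exp (‖c‖ * |x|) : ℂ) * g x‖ := by
        funext x
        rw [(hb x).tsum_eq, norm_mul, Complex.norm_real, Real.norm_eq_abs, Real.abs_exp]
      rw [this]
      exact (hg ‖c‖).norm
    · refine Eventually.of_forall fun x => ?_
      have := NormedSpace.expSeries_div_hasSum_exp (c * x)
      rw [← Complex.exp_eq_exp_ℂ] at this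
      exact this.mul_right _
  have hz : ∀ n : ℕ, ∫ x : ℝ, (c * x) ^ n / n.factorial * g x = 0 := fun n => by
    have e : (fun x : ℝ => (c * x) ^ n / n.factorial * g x)
        = fun x : ℝ => c ^ n / n.factorial * ((x : ℂ) ^ n * g x) := by
      funext x; rw [mul_pow]; ring
    rw [e, integral_const_mul, h, mul_zero]
  simp only [hz] at key
  rw [Real.fourier_eq']
  refine Eq.trans ?_ (hasSum_zero.unique key).symm
  congr 1
  funext x
  rw [smul_eq_mul]
  congr 2
  simp [hc]
  ring

/-- A square integrable function on `X` all of whose Fourier modes vanish is zero. -/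
theorem eq_zero_of_modes (h : L2X)
    (hh : ∀ k : ℤ, ∀ᵐ x : ℝ, ∫ y : Circ, h (x, y) * fourier k y = 0) : h = 0 := by
  have h1 := ae_all_iff.2 hh
  have hi : Integrable (fun p => ‖h p‖ ^ 2) ((volume : Measure ℝ).prod (volume : Measure Circ)) :=
    (memLp_two_iff_integrable_sq_norm (Lp.aestronglyMeasurable h)).1 (Lp.memLp h)
  have hm : ∀ᵐ x : ℝ, AEStronglyMeasurable (fun y : Circ => h (x, y)) volume := by
    have h0 : AEStronglyMeasurable (h : Cyl → ℂ)
        ((volume : Measure ℝ).prod (volume : Measure Circ)) := Lp.aestronglyMeasurable h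
    exact h0.prodMk_left
  have h2 : ∀ᵐ x : ℝ, ∫ y : Circ, ‖h (x, y)‖ ^ 2 = 0 := by
    filter_upwards [h1, hi.prod_right_ae, hm] with x hx1 hx2 hx3
    refine integral_eq_zero_of_ae ?_
    filter_upwards [circ_eq_zero ((memLp_two_iff_integrable_sq_norm hx3).2 hx2) hx1] with y hy
    simp [hy]
  have h3 : ∫ p, ‖h p‖ ^ 2 ∂((volume : Measure ℝ).prod (volume : Measure Circ)) = 0 := by
    rw [integral_prod _ hi, integral_eq_zero_of_ae h2]
  rw [integral_eq_zero_iff_of_nonneg (fun p => by positivity) hi,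
    ← Measure.volume_eq_prod] at h3
  rw [Lp.eq_zero_iff_ae_eq_zero]
  filter_upwards [h3] with p hp
  simpa using hp

theorem mode_zero_of_mem_L20 {h : L2X} (hh : h ∈ L20) :
    ∀ᵐ x : ℝ, ∫ y : Circ, h (x, y) * fourier 0 y = 0 :=
  mode_eq_zero h 0 fun a ha hs => by
    simpa using integral_eq_zero_of_mem_L20 hh ha.continuous hs

/-- If `h` annihilates all Gaussian modes of frequency `k`, its Fourier mode vanishes. -/
theorem mode_eq_zero_of_integral_mode (h : L2X) {b : ℝ} (hb : 0 < b) (k : ℤ)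
    (hh : ∀ p : ℝ[X], ∫ q, h q * mode b k p q = 0) :
    ∀ᵐ x : ℝ, ∫ y : Circ, h (x, y) * fourier k y = 0 := by
  have hi : ∀ (a : ℝ) (p : ℝ[X]), Integrable
      (fun q : Cyl => h q * ((Real.exp (a * |q.1|) : ℂ) * mode b k p q))
      ((volume : Measure ℝ).prod (volume : Measure Circ)) := fun a p =>
    (Lp.memLp h).integrable_mul (q := 2) (memLp_exp_mode hb a k p)
  have e : ∀ (c : ℂ) (x : ℝ) (p : ℝ[X]), ∫ y : Circ, h (x, y) * (c * mode b k p (x, y))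
      = c * ((gp b p x : ℂ) * ∫ y : Circ, h (x, y) * fourier k y) := fun c x p => by
    rw [← integral_const_mul, ← integral_const_mul]
    refine integral_congr_ae (Eventually.of_forall fun y => ?_)
    simp only [mode]
    ring
  -- The n-th moment of this function is the pairing of h with the mode of polynomial X^n. The
  -- Gaussian factor gives the decay and, having no zeros, can be divided out afterwards.
  have key : (fun x : ℝ => (gp b 1 x : ℂ) * ∫ y : Circ, h (x, y) * fourier k y) =ᵐ[volume] 0 := by
    refine ae_eq_zero_of_moments (fun a => ?_) fun n => ?_
    · simpa only [e] using (hi a 1).integral_prod_left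
    · rw [← hh (X ^ n)]
      have hi0 : Integrable (fun q : Cyl => h q * mode b k (X ^ n) q)
          ((volume : Measure ℝ).prod (volume : Measure Circ)) := by simpa using hi 0 (X ^ n)
      refine Eq.trans ?_ (integral_prod _ hi0).symm
      congr 1
      funext x
      have := e 1 x (X ^ n)
      simp only [one_mul] at this
      rw [this]
      simp [gp]
      ring
  filter_upwards [key] with x hx
  refine (mul_eq_zero.1 hx).resolve_left ?_
  simp [gp]

/-! ### Scaled Hermite functions -/

/-- The polynomial part of `φ_{k,n}`, with `b = |k|`. -/
def hermScaled (b : ℝ) (n : ℕ) : ℝ[X] :=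
  C (hermiteConst n * b ^ (1 / 4 : ℝ) * Real.sqrt 2 ^ n)
    * (herm n).comp (C (Real.sqrt (2 * b)) * X)

theorem hermiteConst_pos (n : ℕ) : 0 < hermiteConst n := by
  have := Real.pi_pos
  unfold hermiteConst
  positivity

theorem natDegree_hermScaled {b : ℝ} (hb : 0 < b) (n : ℕ) : (hermScaled b n).natDegree = n := by
  have := hermiteConst_pos n
  rw [hermScaled, natDegree_C_mul (by positivity), natDegree_comp, natDegree_herm,
    natDegree_C_mul_X _ (by positivity), mul_one]

/-- A sequence with one polynomial in each degree spans all polynomials, so testing against Hermite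
functions is as strong as testing against every polynomial times the Gaussian. -/
theorem span_hermScaled {b : ℝ} (hb : 0 < b) : Submodule.span ℝ (range (hermScaled b)) = ⊤ := by
  have h0 : ∀ n, hermScaled b n ≠ 0 := fun n => by
    have := hermiteConst_pos n
    refine mul_ne_zero (C_ne_zero.2 (by positivity)) fun h => ?_
    cases n with
    | zero => simp [herm_zero] at h
    | succ n =>
      have := congrArg natDegree h
      rw [natDegree_comp, natDegree_herm, natDegree_C_mul_X _ (by positivity)] at this
      simp at this
  let S : Polynomial.Sequence ℝ :=
    ⟨hermScaled b, fun n => by rw [degree_eq_natDegree (h0 n), natDegree_hermScaled hb]⟩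
  exact S.span fun n => (leadingCoeff_ne_zero.2 (h0 n)).isUnit

theorem integral_mode_eq_zero_of_hermScaled (h : L2X) {b : ℝ} (hb : 0 < b) (k : ℤ)
    (hh : ∀ n, ∫ q, h q * mode b k (hermScaled b n) q = 0) (p : ℝ[X]) :
    ∫ q, h q * mode b k p q = 0 := by
  have hp : p ∈ Submodule.span ℝ (range (hermScaled b)) := by rw [span_hermScaled hb]; trivial
  induction hp using Submodule.span_induction with
  | mem p hp => obtain ⟨n, rfl⟩ := hp; exact hh n
  | zero => simp [mode, gp]
  | add p q _ _ hp hq =>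
    have e : ∀ x, h x * mode b k (p + q) x = h x * mode b k p x + h x * mode b k q x :=
      fun x => by simp only [mode, gp_add]; push_cast; ring
    simp only [e]
    rw [integral_add (integrable_mul_mode h hb k p) (integrable_mul_mode h hb k q), hp, hq,
      add_zero]
  | smul c p _ hp =>
    have e : ∀ x, h x * mode b k (c • p) x = c * (h x * mode b k p x) :=
      fun x => by simp only [mode, smul_eq_C_mul, gp_C_mul]; push_cast; ring
    simp only [e]
    rw [integral_const_mul, hp, mul_zero]

/-- With b = |k|, the relation between the two normalizations gives H_n(x√b) = 2^{n/2} He_n(√(2b)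
x). -/
theorem eigenfn_eq_mode (k : ℤ) (n : ℕ) :
    eigenfn k n = mode |(k : ℝ)| k (hermScaled |(k : ℝ)| n) := by
  funext q
  simp only [eigenfn, mode, gp, hermScaled, hermiteH, herm, eval_mul, eval_C, eval_comp, eval_X,
    eval_map, aeval_def]
  rw [Real.sqrt_mul zero_le_two]
  congr 2
  rw [show Real.sqrt 2 * (q.1 * Real.sqrt |(k : ℝ)|) = Real.sqrt 2 * Real.sqrt |(k : ℝ)| * q.1
    by ring]
  rw [show algebraMap ℤ ℝ = Int.castRingHom ℝ from rfl]
  ring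

/-! ### Operators that are diagonal in a Hilbert basis -/

section Diagonal

variable {ι H : Type*} [NormedAddCommGroup H] [InnerProductSpace ℂ H]

/-- A bounded sequence of multipliers defines a bounded operator, diagonal in a Hilbert basis. -/
theorem exists_diagonal_clm (b : HilbertBasis ι ℂ H) (m : ι → ℂ) {C : ℝ} (hC : ∀ i, ‖m i‖ ≤ C) :
    ∃ R : H →L[ℂ] H, ∀ f i, b.repr (R f) i = m i * b.repr f i := by
  rcases isEmpty_or_nonempty ι with hι | ⟨⟨i0⟩⟩
  · exact ⟨0, fun f i => (hι.false i).elim⟩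
  have hC0 : 0 ≤ C := (norm_nonneg _).trans (hC i0)
  have hs : ∀ f : lp (fun _ : ι => ℂ) 2, Summable fun i => ‖f i‖ ^ 2 := fun f => by
    simpa using (lp.memℓp f).summable (by norm_num)
  have hle : ∀ (f : lp (fun _ : ι => ℂ) 2) i, ‖m i * f i‖ ^ 2 ≤ C ^ 2 * ‖f i‖ ^ 2 :=
    fun f i => by rw [norm_mul, mul_pow]; gcongr; exact hC i
  have hmem : ∀ f : lp (fun _ : ι => ℂ) 2, Memℓp (fun i => m i * f i) 2 := fun f => by
    refine memℓp_gen ?_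
    simpa using Summable.of_nonneg_of_le (fun i => by positivity) (hle f) ((hs f).mul_left (C ^ 2))
  let D : lp (fun _ : ι => ℂ) 2 →ₗ[ℂ] lp (fun _ : ι => ℂ) 2 :=
    { toFun := fun f => ⟨fun i => m i * f i, hmem f⟩
      map_add' := fun f g => by ext i; exact mul_add _ _ _
      map_smul' := fun c f => by ext i; simp [mul_left_comm] }
  have hD : ∀ f, ‖D f‖ ≤ C * ‖f‖ := fun f => by
    have h1 := lp.norm_rpow_eq_tsum (p := 2) (by norm_num) (D f)
    have h2 := lp.norm_rpow_eq_tsum (p := 2) (by norm_num) f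
    simp only [ENNReal.toReal_ofNat, Real.rpow_ofNat] at h1 h2
    refine abs_le_of_sq_le_sq' ?_ (by positivity) |>.2
    rw [h1, mul_pow, h2, ← tsum_mul_left]
    exact Summable.tsum_le_tsum (hle f) (hs (D f)) ((hs f).mul_left _)
  refine ⟨(b.repr.symm : lp (fun _ : ι => ℂ) 2 →L[ℂ] H) ∘L (D.mkContinuous C hD) ∘L
    (b.repr : H →L[ℂ] lp (fun _ : ι => ℂ) 2), fun f i => ?_⟩
  simp [D]

/-- The spectrum of an operator that is diagonal in a Hilbert basis, with eigenvalues tending to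
infinity, is the set of its eigenvalues. -/
theorem spec_eq_range_of_diagonal (b : HilbertBasis ι ℂ H) (T : H →ₗ.[ℂ] H) (E : ι → ℂ)
    (hT : ∀ (u : T.domain) i, b.repr (T u) i = E i * b.repr (u : H) i)
    (hdom : ∀ u : H, (Summable fun i => ‖E i * b.repr u i‖ ^ 2) → u ∈ T.domain)
    (hE : ∀ N : ℝ, {i | ‖E i‖ ≤ N}.Finite) : spec T = range E := by
  have ext : ∀ {u v : H}, (∀ i, b.repr u i = b.repr v i) → u = v := fun h =>
    b.repr.injective (lp.ext (funext h))
  classical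
  ext z
  constructor
  · contrapose!
    intro hz
    simp only [spec, mem_ofPred_eq, not_not]
    -- Only finitely many eigenvalues have norm at most ‖z‖ + 1; all others are at distance at least
    -- 1 from z. The gap is thus a finite minimum, capped by 1.
    obtain ⟨δ, hδ, hδE⟩ : ∃ δ > 0, ∀ i, δ ≤ ‖E i - z‖ := by
      have hne : ∀ i, 0 < ‖E i - z‖ := fun i =>
        norm_pos_iff.2 (sub_ne_zero.2 fun h => hz ⟨i, h⟩)
      obtain ⟨δ, hδ, h⟩ : ∃ δ > 0, ∀ i ∈ (hE (‖z‖ + 1)).toFinset, δ ≤ ‖E i - z‖ := by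
        rcases (hE (‖z‖ + 1)).toFinset.eq_empty_or_nonempty with h0 | h0
        · exact ⟨1, one_pos, by simp [h0]⟩
        · obtain ⟨i, -, hi⟩ := Finset.exists_min_image _ (fun i => ‖E i - z‖) h0
          exact ⟨_, hne i, hi⟩
      refine ⟨min δ 1, lt_min hδ one_pos, fun i => ?_⟩
      by_cases hi : ‖E i‖ ≤ ‖z‖ + 1
      · exact (min_le_left _ _).trans (h i (by simpa using hi))
      · refine (min_le_right _ _).trans ?_
        have := norm_sub_norm_le (E i) z
        linarith
    have hne : ∀ i, E i - z ≠ 0 := fun i => norm_pos_iff.1 (hδ.trans_le (hδE i))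
    have hinv : ∀ i, ‖(E i - z)⁻¹‖ ≤ δ⁻¹ := fun i => by
      rw [norm_inv]; exact inv_anti₀ hδ (hδE i)
    obtain ⟨R, hR⟩ := exists_diagonal_clm b (fun i => (E i - z)⁻¹) hinv
    -- `S` stands for T R: its boundedness makes the coefficients of R f, multiplied by E, square
    -- summable, which places R f in the domain.
    obtain ⟨S, hS⟩ := exists_diagonal_clm b (fun i => E i * (E i - z)⁻¹) (C := 1 + ‖z‖ * δ⁻¹)
      fun i => by
        have e : E i * (E i - z)⁻¹ = 1 + z * (E i - z)⁻¹ := by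
          have := hne i
          field_simp
          ring
        rw [e]
        refine (norm_add_le _ _).trans ?_
        rw [norm_one, norm_mul]
        gcongr
        exact hinv i
    refine ⟨R, fun f => ?_, fun u => ?_⟩
    · have hf : R f ∈ T.domain := by
        refine hdom _ ?_
        have := (lp.memℓp (b.repr (S f))).summable (by norm_num)
        simpa [hS, hR, mul_assoc] using this
      refine ⟨hf, ext fun i => ?_⟩
      have := hne i
      simp only [map_sub, map_smul, lp.coeFn_sub, lp.coeFn_smul, Pi.sub_apply, Pi.smul_apply,
        smul_eq_mul, hT, hR]
      field_simp
    · refine ext fun i => ?_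
      have := hne i
      simp only [map_sub, map_smul, lp.coeFn_sub, lp.coeFn_smul, Pi.sub_apply, Pi.smul_apply,
        smul_eq_mul, hT, hR]
      field_simp
  -- The basis vector lies in the kernel of T - E i, so a left inverse would send 0 to a unit
  -- vector.
  · rintro ⟨i, rfl⟩ ⟨R, -, hR⟩
    have hi : b i ∈ T.domain := by
      refine hdom _ (summable_of_ne_finset_zero (s := {i}) fun j hj => ?_)
      have hj' : j ≠ i := by simpa using hj
      simp [b.repr_self, lp.single_apply, hj']
    have h0 : T ⟨b i, hi⟩ - E i • b i = 0 := by
      refine ext fun j => ?_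
      simp only [map_sub, map_smul, lp.coeFn_sub, lp.coeFn_smul, Pi.sub_apply, Pi.smul_apply,
        smul_eq_mul, hT]
      simp only [b.repr_self, lp.single_apply]
      by_cases hj : j = i
      · subst hj; simp
      · simp [hj]
    have h1 : R (T ⟨b i, hi⟩ - E i • b i) = b i := hR ⟨b i, hi⟩
    rw [h0, map_zero] at h1
    have h2 := b.orthonormal.1 i
    rw [← h1, norm_zero] at h2
    exact zero_ne_one h2

/-- Square summable combinations of an orthonormal family, reindexed by a map that is injective
where the coefficients do not vanish, are summable. -/
theorem summable_smul_orthonormal {κ : Type*} [CompleteSpace H] {v : κ → H}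
    (hv : Orthonormal ℂ v) (f : ι → κ) (a : ι → ℂ) (ha : Summable fun i => ‖a i‖ ^ 2)
    (hf : InjOn f (Function.support a)) : Summable fun i => a i • v (f i) := by
  have hv' : Orthonormal ℂ fun i : Function.support a => v (f i) :=
    hv.comp _ fun i j h => Subtype.ext (hf i.2 j.2 h)
  have h := (hv'.orthogonalFamily.summable_iff_norm_sq_summable
    (fun i : Function.support a => a i)).2 (ha.comp_injective Subtype.val_injective)
  rw [← Function.Injective.summable_iff (Subtype.val_injective (p := (· ∈ Function.support a)))]
  · simpa [Function.comp_def] using h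
  · intro i hi
    have : a i = 0 := by simpa using hi
    simp [this]

end Diagonal

/-! ### Orthonormality of the modes -/

theorem integral_fourier (m : ℤ) : ∫ y : Circ, fourier m y = if m = 0 then 2 * Real.pi else 0 := by
  have h := AddCircle.intervalIntegral_preimage (2 * Real.pi) 0 fun y => fourier m y
  rw [← h]
  split_ifs with hm
  · subst hm; simp
  · have hI : Complex.I * m ≠ 0 := mul_ne_zero Complex.I_ne_zero (by exact_mod_cast hm)
    have hd : ∀ y : ℝ, HasDerivAt (fun t : ℝ => (Complex.I * m)⁻¹ * fourier m (t : Circ))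
        (fourier m (y : Circ)) y := fun y =>
      ((hasDerivAt_fourier_mk m y).const_mul _).congr_deriv (by
        rw [← mul_assoc, inv_mul_cancel₀ hI, one_mul])
    have hc : Continuous fun t : ℝ => fourier m (t : Circ) :=
      (fourier m).continuous.comp (AddCircle.continuous_mk' _)
    rw [intervalIntegral.integral_eq_sub_of_hasDerivAt (fun t _ => hd t)
      (hc.intervalIntegrable _ _), zero_add, AddCircle.coe_period, AddCircle.coe_zero, sub_self,
      Complex.ofReal_zero]

theorem conj_mode (b : ℝ) (k : ℤ) (p : ℝ[X]) (q : Cyl) :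
    (starRingEnd ℂ) (mode b k p q) = mode b (-k) p q := by
  simp only [mode, map_mul, Complex.conj_ofReal, fourier_neg]

/-- The inner product conjugates its first argument, hence the frequency -k here and in all later
pairings. -/
theorem inner_modeL {b : ℝ} (hb : 0 < b) (k : ℤ) (p : ℝ[X]) (u : L2X) :
    inner ℂ (modeL hb k p) u = ∫ q, u q * mode b (-k) p q := by
  rw [L2.inner_def]
  refine integral_congr_ae ?_
  filter_upwards [coeFn_modeL hb k p] with q hq
  rw [hq, RCLike.inner_apply, conj_mode]

theorem integral_mode_mul_mode (b b' : ℝ) (k k' : ℤ) (p p' : ℝ[X]) :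
    ∫ q, mode b k p q * mode b' k' p' q
      = ((∫ x, gp b p x * gp b' p' x : ℝ) : ℂ) * if k + k' = 0 then 2 * Real.pi else 0 := by
  rw [← integral_fourier, ← integral_complex_ofReal]
  refine Eq.trans ?_ (integral_prod_mul (μ := (volume : Measure ℝ)) (ν := (volume : Measure Circ))
    (fun x => ((gp b p x * gp b' p' x : ℝ) : ℂ)) fun y => fourier (k + k') y)
  refine integral_congr_ae (Eventually.of_forall fun q => ?_)
  simp only [mode, fourier_add]
  push_cast
  ring

/-- Two factors e^{-bx²/2} multiply to e^{-bx²}, which is e^{-t²/2} at t = √(2b) x: this explains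
the scaling. -/
theorem gp_comp_mul {b : ℝ} (hb : 0 < b) (p q : ℝ[X]) (x : ℝ) :
    gp b (p.comp (C (Real.sqrt (2 * b)) * X)) x * gp b (q.comp (C (Real.sqrt (2 * b)) * X)) x
      = gp 1 (p * q) (Real.sqrt (2 * b) * x) := by
  have h : Real.sqrt (2 * b) ^ 2 = 2 * b := Real.sq_sqrt (by positivity)
  simp only [gp, eval_comp, eval_mul, eval_C, eval_X, mul_pow, h]
  rw [show -(2 * b * x ^ 2 * 1) / 2 = -(x ^ 2 * b) / 2 + -(x ^ 2 * b) / 2 by ring, Real.exp_add]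
  ring

/-- The leading constant in the polynomial part of `φ_{k,n}`. -/
def hermCoef (b : ℝ) (n : ℕ) : ℝ := hermiteConst n * b ^ (1 / 4 : ℝ) * Real.sqrt 2 ^ n

theorem hermScaled_eq (b : ℝ) (n : ℕ) :
    hermScaled b n = C (hermCoef b n) * (herm n).comp (C (Real.sqrt (2 * b)) * X) := rfl

theorem hermCoef_pos {b : ℝ} (hb : 0 < b) (n : ℕ) : 0 < hermCoef b n := by
  have := hermiteConst_pos n
  unfold hermCoef
  positivity

theorem hermCoef_sq {b : ℝ} (hb : 0 < b) (n : ℕ) :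
    hermCoef b n ^ 2 = Real.sqrt b / (n.factorial * Real.sqrt Real.pi * (2 * Real.pi)) := by
  have hpi := Real.pi_pos
  have h1 : (b ^ (1 / 4 : ℝ)) ^ 2 = Real.sqrt b := by
    rw [← Real.rpow_natCast, ← Real.rpow_mul hb.le, Real.sqrt_eq_rpow]; norm_num
  have h2 : (Real.sqrt 2 ^ n) ^ 2 = 2 ^ n := by
    rw [← pow_mul, mul_comm, pow_mul, Real.sq_sqrt zero_le_two]
  rw [hermCoef, mul_pow, mul_pow, h1, h2, hermiteConst, inv_pow, Real.sq_sqrt (by positivity)]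
  field_simp

/-- Turns the recurrence of the monic polynomials into that of the normalized ones, whose matrix is
symmetric. -/
theorem hermCoef_succ_succ {b : ℝ} (hb : 0 < b) (n : ℕ) :
    Real.sqrt (((n : ℝ) + 1) * (n + 2)) * hermCoef b (n + 2) = hermCoef b n := by
  have h0 := hermCoef_pos hb n
  have h2 := hermCoef_pos hb (n + 2)
  have hpi := Real.pi_pos
  refine (sq_eq_sq₀ (by positivity) h0.le).1 ?_
  rw [mul_pow, Real.sq_sqrt (by positivity), hermCoef_sq hb, hermCoef_sq hb, Nat.factorial_succ,
    Nat.factorial_succ]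
  push_cast
  field_simp
  ring

/-- The squared norm in x is (2π)⁻¹, since the circle contributes the remaining factor 2π. -/
theorem integral_hermScaled {b : ℝ} (hb : 0 < b) (m n : ℕ) :
    ∫ x, gp b (hermScaled b m) x * gp b (hermScaled b n) x
      = if m = n then (2 * Real.pi)⁻¹ else 0 := by
  have e : ∀ x, gp b (hermScaled b m) x * gp b (hermScaled b n) x
      = hermCoef b m * hermCoef b n * gp 1 (herm m * herm n) (Real.sqrt (2 * b) * x) := fun x => by
    rw [hermScaled_eq, hermScaled_eq, gp_C_mul, gp_C_mul, ← gp_comp_mul hb]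
    ring
  have hpi := Real.pi_pos
  simp only [e]
  rw [integral_const_mul, Measure.integral_comp_mul_left, integral_gp_herm_mul_herm]
  split_ifs with h
  · subst h
    rw [← pow_two, hermCoef_sq hb, abs_of_nonneg (by positivity), smul_eq_mul,
      Real.sqrt_mul zero_le_two, Real.sqrt_mul zero_le_two]
    have := Real.sqrt_pos.2 hb
    field_simp
  · simp

/-! ### The Hilbert basis -/

/-- The index set of the basis. -/
abbrev Idx : Type := {k : ℤ // k ≠ 0} × ℕ

theorem abs_pos_of_idx (k : {k : ℤ // k ≠ 0}) : 0 < |((k : ℤ) : ℝ)| :=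
  abs_pos.2 (by exact_mod_cast k.2)

/-- `φ_{k,n}` as an element of `L²(X)`. -/
def basisL (i : Idx) : L2X :=
  modeL (abs_pos_of_idx i.1) i.1 (hermScaled |((i.1 : ℤ) : ℝ)| i.2)

theorem orthonormal_basisL : Orthonormal ℂ basisL := by
  rw [orthonormal_iff_ite]
  rintro ⟨⟨k, hk⟩, n⟩ ⟨⟨k', hk'⟩, n'⟩
  simp only [basisL]
  rw [inner_modeL, integral_modeL_mul, integral_mode_mul_mode]
  by_cases h : k = k'
  · subst h
    rw [integral_hermScaled (abs_pos_of_idx ⟨k, hk⟩)]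
    have hpi : (Real.pi : ℂ) ≠ 0 := by exact_mod_cast Real.pi_ne_zero
    by_cases hn : n = n'
    · subst hn
      simp
      field_simp
    · simp [hn, Ne.symm hn]
  · have : ¬ (k' + -k = 0) := fun h' => h (by omega)
    simp [h, this]

theorem modeL_mem_L20 {b : ℝ} (hb : 0 < b) {k : ℤ} (hk : k ≠ 0) (p : ℝ[X]) :
    modeL hb k p ∈ L20 := by
  refine mem_L20_of_mean _ ?_
  have h : ∀ᵐ q ∂((volume : Measure ℝ).prod (volume : Measure Circ)),
      modeL hb k p q = mode b k p q := coeFn_modeL hb k p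
  filter_upwards [Measure.ae_ae_of_ae_prod h] with x hx
  rw [integral_congr_ae hx]
  simp only [mode]
  rw [integral_const_mul, integral_fourier, if_neg hk, Complex.ofReal_zero, mul_zero]

/-- `φ_{k,n}` as an element of `L²₀(X)`. -/
def basisVec (i : Idx) : L20 := ⟨basisL i, modeL_mem_L20 _ i.1.2 _⟩

theorem orthonormal_basisVec : Orthonormal ℂ basisVec := by
  have h := orthonormal_basisL
  rw [orthonormal_iff_ite] at h ⊢
  exact h

theorem basisVec_orthogonal_eq_bot : (Submodule.span ℂ (range basisVec))ᗮ = ⊥ := by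
  rw [eq_bot_iff]
  intro u hu
  rw [Submodule.mem_orthogonal] at hu
  have h : ∀ i, inner ℂ (basisL i) (u : L2X) = 0 := fun i =>
    hu _ (Submodule.subset_span ⟨i, rfl⟩)
  rw [Submodule.mem_bot]
  refine Subtype.ext (eq_zero_of_modes _ fun k => ?_)
  by_cases hk : k = 0
  · subst hk
    exact mode_zero_of_mem_L20 u.2
  -- Orthogonality to the basis vectors of frequency -k is what kills the integrals against e^{iky}.
  · have hb := abs_pos_of_idx ⟨-k, neg_ne_zero.2 hk⟩
    refine mode_eq_zero_of_integral_mode _ hb k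
      (integral_mode_eq_zero_of_hermScaled _ hb k fun n => ?_)
    have := h (⟨-k, neg_ne_zero.2 hk⟩, n)
    rwa [basisL, inner_modeL, neg_neg] at this

/-- The Hilbert basis `φ_{k,n}` of `L²₀(X)`. -/
def grushinBasis : HilbertBasis Idx ℂ L20 :=
  HilbertBasis.mkOfOrthogonalEqBot orthonormal_basisVec basisVec_orthogonal_eq_bot

theorem grushinBasis_apply (i : Idx) : grushinBasis i = basisVec i := by
  rw [grushinBasis, HilbertBasis.coe_mkOfOrthogonalEqBot]

theorem grushinBasis_repr (u : L20) (i : Idx) :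
    grushinBasis.repr u i = inner ℂ (basisL i) (u : L2X) := by
  rw [grushinBasis.repr_apply_apply, grushinBasis_apply]
  rfl

/-! ### Action of the operator on the basis -/

/-- The oscillator equation f'' = b²x²f - (2n+1)bf, obtained from the Hermite equation by the
substitution x ↦ √(2b) x. -/
theorem gpD_gpD_hermScaled {b : ℝ} (hb : 0 < b) (n : ℕ) :
    gpD b (gpD b (hermScaled b n))
      = C (b ^ 2) * (X ^ 2 * hermScaled b n) - C ((2 * n + 1) * b) * hermScaled b n := by
  have h : (C (Real.sqrt (2 * b)) : ℝ[X]) ^ 2 = 2 * C b := by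
    rw [← C_pow, Real.sq_sqrt (by positivity), C_mul]; rfl
  have ode := congrArg (fun p => p.comp (C (Real.sqrt (2 * b)) * X)) (herm_ode n)
  simp only [add_comp, sub_comp, mul_comp, X_comp, natCast_comp, zero_comp] at ode
  simp only [gpD, hermScaled_eq, derivative_sub, derivative_mul, derivative_C, derivative_X,
    derivative_comp, derivative_zero, derivative_one, map_add, map_mul, map_pow, map_one, map_natCast, C_ofNat]
  linear_combination (2 * C b * C (hermCoef b n)) * ode
    + (C (hermCoef b n) * ((derivative (derivative (herm n))).comp (C (Real.sqrt (2 * b)) * X))) * h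

/-- The coefficient of `φ_{k,n-2}` in `2|k|x² φ_{k,n}`; it vanishes for `n < 2`. -/
def lowerCoef (n : ℕ) : ℝ := Real.sqrt ((n : ℝ) * (n - 1))

/-- The coefficient of `φ_{k,n+2}` in `2|k|x² φ_{k,n}`. -/
def upperCoef (n : ℕ) : ℝ := Real.sqrt (((n : ℝ) + 1) * (n + 2))

/-- In the normalized Hermite functions x² has three diagonals. For n < 2 the truncated index `n -
2` is harmless, as its coefficient is zero. -/
theorem X_sq_mul_hermScaled {b : ℝ} (hb : 0 < b) (n : ℕ) :
    C (2 * b) * (X ^ 2 * hermScaled b n)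
      = C (upperCoef n) * hermScaled b (n + 2) + C (2 * (n : ℝ) + 1) * hermScaled b n
        + C (lowerCoef n) * hermScaled b (n - 2) := by
  have h : (C (Real.sqrt (2 * b)) : ℝ[X]) ^ 2 = C (2 * b) := by
    rw [← C_pow, Real.sq_sqrt (by positivity)]
  have hu : (C (upperCoef n) : ℝ[X]) * C (hermCoef b (n + 2)) = C (hermCoef b n) := by
    rw [← C_mul, upperCoef, hermCoef_succ_succ hb]
  rw [hermScaled_eq, hermScaled_eq, hermScaled_eq b (n - 2), ← mul_assoc (C (upperCoef n)), hu, ← h]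
  clear hu h
  generalize Real.sqrt (2 * b) = c
  match n with
  | 0 =>
    have r := congrArg (fun p => p.comp (C c * X)) X_sq_mul_herm_zero
    simp only [add_comp, mul_comp, pow_comp, X_comp] at r
    simp [lowerCoef]
    linear_combination C (hermCoef b 0) * r
  | 1 =>
    have r := congrArg (fun p => p.comp (C c * X)) X_sq_mul_herm_one
    simp only [add_comp, mul_comp, pow_comp, X_comp, ofNat_comp] at r
    simp [lowerCoef]
    push_cast at r
    have h2 : (C 2 : ℝ[X]) = 2 := rfl
    rw [h2]
    linear_combination C (hermCoef b 1) * r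
  | n + 2 =>
    have r := congrArg (fun p => p.comp (C c * X)) (X_sq_mul_herm n)
    simp only [add_comp, mul_comp, pow_comp, X_comp, ofNat_comp, natCast_comp, one_comp] at r
    have e : lowerCoef (n + 2) * hermCoef b n = (n + 2) * (n + 1) * hermCoef b (n + 2) := by
      rw [← hermCoef_succ_succ hb n, ← mul_assoc, lowerCoef]
      push_cast
      rw [show ((n : ℝ) + 2) * (n + 2 - 1) = (n + 1) * (n + 2) by ring,
        Real.mul_self_sqrt (by positivity)]
      ring
    have e' := congrArg (C : ℝ → ℝ[X]) e
    simp only [map_mul, map_add, map_natCast, map_one, C_ofNat] at e'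
    rw [Nat.add_sub_cancel]
    push_cast
    simp only [map_mul, map_add, map_natCast, map_one, C_ofNat]
    linear_combination C (hermCoef b (n + 2)) * r
      - ((herm n).comp (C c * X)) * e'

/-! ### The operator in the Hilbert basis -/

/-- The frequency `|k|` of an index. -/
def Idx.freq (i : Idx) : ℝ := |((i.1 : ℤ) : ℝ)|

theorem Idx.freq_pos (i : Idx) : 0 < i.freq := abs_pos_of_idx i.1

theorem Idx.freq_sq (i : Idx) : i.freq ^ 2 = ((i.1 : ℤ) : ℝ) ^ 2 := sq_abs _

/-- The energy of an index. -/
def Idx.energy (s : ℝ) (i : Idx) : ℝ := Grushin.energy s i.1 i.2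

theorem Idx.energy_eq (s : ℝ) (i : Idx) :
    i.energy s = (2 * i.2 + 1) * i.freq + i.freq ^ 2 * s ^ 2 := by
  rw [Idx.freq_sq]; rfl

/-- `V ∂_y² φ_{k,n}` as an element of `L²(X)`. -/
def basisVDyy (s : ℝ) (i : Idx) : L2X :=
  ((-((i.1 : ℤ) : ℝ) ^ 2 : ℝ) : ℂ) • modeL i.freq_pos i.1 (potentialPoly s * hermScaled i.freq i.2)

theorem isWeakVDyy_basisL (s : ℝ) (i : Idx) :
    IsWeakVDyy (potential s) (basisL i) (basisVDyy s i) :=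
  isWeakVDyy_modeL s i.freq_pos _ _

theorem hermScaled_eigen (s : ℝ) (i : Idx) :
    gpD i.freq (gpD i.freq (hermScaled i.freq i.2))
      = C (((i.1 : ℤ) : ℝ) ^ 2) * (potentialPoly s * hermScaled i.freq i.2)
        - C (i.energy s) * hermScaled i.freq i.2 := by
  rw [gpD_gpD_hermScaled i.freq_pos, i.energy_eq, ← i.freq_sq, potentialPoly]
  simp only [map_mul, map_add, map_pow]
  ring

theorem isWeakDxx_basisL (s : ℝ) (i : Idx) :
    IsWeakDxx (basisL i) (-basisVDyy s i - (i.energy s : ℂ) • basisL i) := by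
  have h := isWeakDxx_modeL i.freq_pos i.1 (hermScaled i.freq i.2)
  rw [hermScaled_eigen s, sub_eq_add_neg, ← neg_mul, ← C_neg, modeL_add, modeL_C_mul,
    modeL_C_mul] at h
  have e : -basisVDyy s i - (i.energy s : ℂ) • basisL i
      = -basisVDyy s i - (i.energy s : ℂ) • modeL i.freq_pos i.1 (hermScaled i.freq i.2) := rfl
  rw [e, basisVDyy, Complex.ofReal_neg, neg_smul, neg_neg, sub_eq_add_neg, ← neg_smul,
    ← Complex.ofReal_neg]
  exact h

/-- The vectors V∂_y²φ are not orthogonal; this splits them into three orthonormal families with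
scalar weights, for which convergence is a matter of square sums. The factor |k|/2 comes from k²x² =
(|k|/2)(2|k|x²). -/
theorem basisVDyy_eq (s : ℝ) (i : Idx) :
    basisVDyy s i = (-(i.freq / 2 * upperCoef i.2) : ℂ) • basisL (i.1, i.2 + 2)
      + (-(i.freq / 2 * (2 * i.2 + 1) + i.freq ^ 2 * s ^ 2) : ℂ) • basisL i
      + (-(i.freq / 2 * lowerCoef i.2) : ℂ) • basisL (i.1, i.2 - 2) := by
  have hb := i.freq_pos
  have e : C (i.freq ^ 2) * (potentialPoly s * hermScaled i.freq i.2)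
      = C (i.freq / 2 * upperCoef i.2) * hermScaled i.freq (i.2 + 2)
      + (C (i.freq / 2 * (2 * i.2 + 1) + i.freq ^ 2 * s ^ 2) * hermScaled i.freq i.2
      + C (i.freq / 2 * lowerCoef i.2) * hermScaled i.freq (i.2 - 2)) := by
    have h := X_sq_mul_hermScaled hb i.2
    have h2 : C (i.freq ^ 2) * (X ^ 2 * hermScaled i.freq i.2)
        = C (i.freq / 2) * (C (2 * i.freq) * (X ^ 2 * hermScaled i.freq i.2)) := by
      rw [← mul_assoc (C (i.freq / 2)), ← C_mul]; congr 2; ring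
    rw [potentialPoly, add_mul, mul_add, h2, h]
    simp only [map_mul, map_add, map_pow]
    ring
  have e2 := congrArg (modeL hb i.1) e
  rw [modeL_C_mul, modeL_add, modeL_add, modeL_C_mul, modeL_C_mul, modeL_C_mul] at e2
  rw [basisVDyy, ← i.freq_sq]
  have e3 : ∀ n, basisL (i.1, n) = modeL hb i.1 (hermScaled i.freq n) := fun n => rfl
  have e4 : basisL i = modeL hb i.1 (hermScaled i.freq i.2) := rfl
  rw [e3 (i.2 + 2), e3 (i.2 - 2), e4, Complex.ofReal_neg, neg_smul, e2]
  push_cast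
  module

/-- The bound is chosen so that, after multiplication by |k|/2, it becomes (2n+1)|k|, which is at
most the energy. -/
theorem upperCoef_le (n : ℕ) : upperCoef n ≤ 2 * (2 * n + 1) := by
  refine Real.sqrt_le_iff.2 ⟨by positivity, ?_⟩
  nlinarith [(Nat.cast_nonneg n : (0 : ℝ) ≤ n)]

theorem lowerCoef_le (n : ℕ) : lowerCoef n ≤ 2 * (2 * n + 1) := by
  refine Real.sqrt_le_iff.2 ⟨by positivity, ?_⟩
  nlinarith [(Nat.cast_nonneg n : (0 : ℝ) ≤ n)]

theorem freq_mul_le_energy (s : ℝ) (i : Idx) {c : ℝ} (hc : c ≤ 2 * (2 * i.2 + 1)) :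
    i.freq / 2 * c ≤ i.energy s := by
  have hb := i.freq_pos
  rw [i.energy_eq]
  have : i.freq / 2 * c ≤ i.freq / 2 * (2 * (2 * i.2 + 1)) := by gcongr
  nlinarith [mul_nonneg (sq_nonneg i.freq) (sq_nonneg s)]

theorem energy_nonneg (s : ℝ) (i : Idx) : 0 ≤ i.energy s := by
  have hb := i.freq_pos
  rw [i.energy_eq]
  positivity

/-- If `Σ E² |c|² < ∞`, then `Σ c V ∂_y² φ` converges. -/
theorem summable_basisVDyy (s : ℝ) (c : Idx → ℂ)
    (hc : Summable fun i => ‖(i.energy s : ℂ) * c i‖ ^ 2) :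
    Summable fun i => c i • basisVDyy s i := by
  have key : ∀ (r : Idx → ℝ), (∀ i, 0 ≤ r i) → (∀ i, r i ≤ i.energy s) →
      Summable fun i => ‖(-(r i) : ℂ) * c i‖ ^ 2 := fun r h0 h1 => by
    refine Summable.of_nonneg_of_le (fun i => by positivity) (fun i => ?_) hc
    rw [norm_mul, norm_mul, norm_neg, Complex.norm_real, Complex.norm_real,
      Real.norm_of_nonneg (h0 i), Real.norm_of_nonneg (energy_nonneg s i)]
    exact pow_le_pow_left₀ (mul_nonneg (h0 i) (norm_nonneg _))
      (mul_le_mul_of_nonneg_right (h1 i) (norm_nonneg _)) 2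
  have hb := fun i : Idx => i.freq_pos.le
  have s1 := summable_smul_orthonormal orthonormal_basisL (fun i : Idx => (i.1, i.2 + 2)) _
    (key (fun i => i.freq / 2 * upperCoef i.2)
      (fun i => mul_nonneg (by linarith [hb i]) (Real.sqrt_nonneg _))
      fun i => freq_mul_le_energy s i (upperCoef_le _))
    (fun i _ j _ h => by
      rw [Prod.mk.injEq] at h
      exact Prod.ext h.1 (by omega))
  have s2 := summable_smul_orthonormal orthonormal_basisL id _
    (key (fun i => i.freq / 2 * (2 * i.2 + 1) + i.freq ^ 2 * s ^ 2)
      (fun i => by have := hb i; positivity)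
      fun i => by
        have := hb i
        rw [i.energy_eq]
        have : 0 ≤ (2 * (i.2 : ℝ) + 1) * i.freq := by positivity
        linarith)
    Function.injective_id.injOn
  have s3 := summable_smul_orthonormal orthonormal_basisL (fun i : Idx => (i.1, i.2 - 2)) _
    (key (fun i => i.freq / 2 * lowerCoef i.2)
      (fun i => mul_nonneg (by linarith [hb i]) (Real.sqrt_nonneg _))
      fun i => freq_mul_le_energy s i (lowerCoef_le _))
    -- The shift n ↦ n - 2 is truncated and sends 0, 1 and 2 to 0; it is injective on the support
    -- because the coefficient vanishes for n < 2.
    (by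
      have h2 : ∀ i : Idx, i ∈ Function.support
          (fun i : Idx => (-((i.freq / 2 * lowerCoef i.2 : ℝ)) : ℂ) * c i) → 2 ≤ i.2 := by
        intro i hi
        by_contra hlt
        refine hi ?_
        have : i.2 = 0 ∨ i.2 = 1 := by omega
        rcases this with h | h <;> simp [lowerCoef, h]
      intro i hi j hj h
      have hi' := h2 i hi
      have hj' := h2 j hj
      rw [Prod.mk.injEq] at h
      exact Prod.ext h.1 (by omega))
  refine ((s1.add s2).add s3).congr fun i => ?_
  rw [basisVDyy_eq]
  simp only [id]
  push_cast
  module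

/-! ### Weak equations pass to convergent sums. -/

theorem exists_clm_integral_mul {ψ : Cyl → ℂ} (hψ : MemLp ψ 2) :
    ∃ L : L2X →L[ℂ] ℂ, ∀ u, L u = ∫ q, u q * ψ q := by
  have h : MemLp (fun q => (starRingEnd ℂ) (ψ q)) 2 := hψ.star
  refine ⟨innerSL ℂ (h.toLp _), fun u => ?_⟩
  rw [innerSL_apply_apply, L2.inner_def]
  refine integral_congr_ae ?_
  filter_upwards [h.coeFn_toLp] with q hq
  rw [hq, RCLike.inner_apply, Complex.conj_conj]

theorem integral_mul_eq_of_hasSum {ι : Type*} {ψ χ : Cyl → ℂ} (hψ : MemLp ψ 2) (hχ : MemLp χ 2)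
    {f g : ι → L2X} {u v : L2X} (hf : HasSum f u) (hg : HasSum g v)
    (h : ∀ i, ∫ q, f i q * ψ q = ∫ q, g i q * χ q) : ∫ q, u q * ψ q = ∫ q, v q * χ q := by
  obtain ⟨L, hL⟩ := exists_clm_integral_mul hψ
  obtain ⟨M, hM⟩ := exists_clm_integral_mul hχ
  have h1 := hf.mapL L
  have h2 := hg.mapL M
  simp only [hL, hM] at h1 h2
  simp only [h] at h1
  exact h1.unique h2

theorem IsTest.memLp {φ : Cyl → ℂ} (hφ : IsTest φ) : MemLp φ 2 :=
  hφ.continuous.memLp_of_hasCompactSupport hφ.compact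

theorem IsWeakDxx.of_hasSum {ι : Type*} {f g : ι → L2X} {u v : L2X} (hf : HasSum f u)
    (hg : HasSum g v) (h : ∀ i, IsWeakDxx (f i) (g i)) : IsWeakDxx u v := fun φ hφ =>
  integral_mul_eq_of_hasSum hφ.dx.dx.memLp hφ.memLp hf hg fun i => h i φ hφ

theorem IsWeakVDyy.of_hasSum {V : C(ℝ, ℝ)} {ι : Type*} {f g : ι → L2X} {u v : L2X}
    (hf : HasSum f u) (hg : HasSum g v) (h : ∀ i, IsWeakVDyy V (f i) (g i)) :
    IsWeakVDyy V u v := fun φ hφ => by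
  refine integral_mul_eq_of_hasSum ?_ hφ.memLp hf hg fun i => h i φ hφ
  refine Continuous.memLp_of_hasCompactSupport ?_ hφ.dy.dy.compact.mul_left
  have := hφ.dy.dy.continuous
  fun_prop

theorem grushinBasis_hasSum (u : L20) :
    HasSum (fun i => grushinBasis.repr u i • basisL i) (u : L2X) := by
  have h := (grushinBasis.hasSum_repr u).mapL L20.subtypeL
  simp only [grushinBasis_apply, map_smul] at h
  exact h

/-- The series for V∂_y²u converges by the three-diagonal estimate. The one for ∂ₓ²u then follows
from ∂ₓ²φ = -V∂_y²φ - Eφ, and both limits are the weak derivatives of u. -/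
theorem mem_domain_of_summable (s : ℝ) (u : L20)
    (hu : Summable fun i => ‖(i.energy s : ℂ) * grushinBasis.repr u i‖ ^ 2) :
    u ∈ (grushinS s).domain := by
  have h0 := grushinBasis_hasSum u
  have h1 := (summable_basisVDyy s _ hu).hasSum
  have h2 := (summable_smul_orthonormal orthonormal_basisL id _ hu
    Function.injective_id.injOn).hasSum
  refine ⟨⟨_, IsWeakDxx.of_hasSum h0 (h1.neg.sub h2) fun i => ?_⟩,
    ⟨_, IsWeakVDyy.of_hasSum h0 h1 fun i => (isWeakVDyy_basisL s i).smul _⟩⟩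
  convert (isWeakDxx_basisL s i).smul (grushinBasis.repr u i) using 1
  simp only [id]
  module

theorem grushinS_apply {s : ℝ} (u : (grushinS s).domain) {g h : L2X}
    (hg : IsWeakDxx ((u : L20) : L2X) g) (hh : IsWeakVDyy (potential s) ((u : L20) : L2X) h) :
    ((grushinS s u : L20) : L2X) = -g - h := by
  rw [hg.unique (weakDxx_spec u), hh.unique (weakVDyy_spec u)]
  rfl

/-- Symmetry against the eigenfunctions: both weak terms are moved onto φ_{k,n}, where the V-terms
cancel and E φ_{k,n} remains. The φ_{k,n} lack compact support, which is why the `integral_mode`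
lemmas are needed. -/
theorem repr_grushinS (s : ℝ) (u : (grushinS s).domain) (i : Idx) :
    grushinBasis.repr (grushinS s u) i
      = (i.energy s : ℂ) * grushinBasis.repr (u : L20) i := by
  obtain ⟨⟨g, hg⟩, ⟨h, hh⟩⟩ := u.2
  rw [grushinBasis_repr, grushinBasis_repr, grushinS_apply u hg hh, inner_sub_right,
    inner_neg_right]
  have e1 := hg.integral_mode i.freq_pos (-i.1) (hermScaled i.freq i.2)
  have e2 := IsWeakVDyy.integral_mode hh i.freq_pos (-i.1) (hermScaled i.freq i.2)
  rw [← inner_modeL i.freq_pos, ← inner_modeL i.freq_pos, hermScaled_eigen s, sub_eq_add_neg, ← neg_mul, ← C_neg,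
    modeL_add, modeL_C_mul, modeL_C_mul, inner_add_left, inner_smul_left, inner_smul_left,
    Complex.conj_ofReal, Complex.conj_ofReal] at e1
  rw [← inner_modeL i.freq_pos, ← inner_modeL i.freq_pos] at e2
  have e4 : basisL i = modeL i.freq_pos i.1 (hermScaled i.freq i.2) := rfl
  rw [e4, ← e1, ← e2]
  push_cast
  ring

/-- Since |k| ≥ 1, the term (2n+1)|k| bounds both |k| and n; this is where the absence of the
frequency k = 0 is used. -/
theorem finite_energy_le (s N : ℝ) : {i : Idx | ‖(i.energy s : ℂ)‖ ≤ N}.Finite := by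
  obtain ⟨M, hM⟩ := exists_nat_ge N
  have hfin : ((Set.Icc (-(M : ℤ)) M) ×ˢ (Set.Iic M) : Set (ℤ × ℕ)).Finite :=
    (Set.finite_Icc _ _).prod (Set.finite_Iic _)
  refine (hfin.preimage (f := fun i : Idx => ((i.1 : ℤ), i.2)) ?_).subset fun i hi => ?_
  · rintro ⟨i, n⟩ _ ⟨j, m⟩ _ h
    simp only [Prod.mk.injEq] at h
    exact Prod.ext (Subtype.ext h.1) h.2
  · have h1 : i.energy s ≤ M := by
      have : ‖(i.energy s : ℂ)‖ ≤ N := hi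
      rw [Complex.norm_real, Real.norm_of_nonneg (energy_nonneg s i)] at this
      exact this.trans hM
    have hk : 1 ≤ i.freq := by
      rw [Idx.freq, ← Int.cast_abs]
      exact_mod_cast Int.one_le_abs i.1.2
    have hn : (0 : ℝ) ≤ i.2 := Nat.cast_nonneg _
    have h2 : (2 * (i.2 : ℝ) + 1) * i.freq ≤ M := by
      rw [i.energy_eq] at h1
      nlinarith [mul_nonneg (sq_nonneg i.freq) (sq_nonneg s)]
    have h3 : i.freq ≤ M := by nlinarith
    have h4 : (i.2 : ℝ) ≤ M := by nlinarith
    refine ⟨?_, by exact_mod_cast h4⟩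
    rw [Idx.freq, ← Int.cast_abs] at h3
    have h5 : |(i.1 : ℤ)| ≤ (M : ℤ) := by exact_mod_cast h3
    exact abs_le.1 h5

theorem grushinBasis_mem_domain (s : ℝ) (i : Idx) : grushinBasis i ∈ (grushinS s).domain := by
  rw [grushinBasis_apply]
  exact ⟨⟨_, isWeakDxx_basisL s i⟩, ⟨_, isWeakVDyy_basisL s i⟩⟩

theorem grushinS_grushinBasis (s : ℝ) (i : Idx) :
    grushinS s ⟨grushinBasis i, grushinBasis_mem_domain s i⟩
      = (i.energy s : ℂ) • grushinBasis i := by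
  refine grushinBasis.repr.injective (lp.ext (funext fun j => ?_))
  rw [repr_grushinS, map_smul, lp.coeFn_smul, Pi.smul_apply, smul_eq_mul]
  classical
  rw [grushinBasis.repr_self, lp.single_apply]
  by_cases h : j = i
  · subst h; rfl
  · simp [h]

end

end Grushin

theorem mainTheorem5 (s : ℝ) :
    Grushin.spec (Grushin.grushinS s) =
        {z : ℂ | ∃ (n : ℕ) (k : ℤ), k ≠ 0 ∧ z = (Grushin.energy s k n : ℂ)} ∧
      ∃ b : HilbertBasis ({k : ℤ // k ≠ 0} × ℕ) ℂ Grushin.L20,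
        ∀ (k : {k : ℤ // k ≠ 0}) (n : ℕ),
          (((b (k, n) : Grushin.L20) : Grushin.L2X) : Grushin.Cyl → ℂ)
              =ᵐ[MeasureTheory.volume] Grushin.eigenfn k n ∧
            ∃ h : b (k, n) ∈ (Grushin.grushinS s).domain,
              Grushin.grushinS s ⟨b (k, n), h⟩ = (Grushin.energy s k n : ℂ) • b (k, n) := by
  refine ⟨?_, Grushin.grushinBasis, fun k n => ⟨?_, Grushin.grushinBasis_mem_domain s (k, n),
    Grushin.grushinS_grushinBasis s (k, n)⟩⟩
  · rw [Grushin.spec_eq_range_of_diagonal Grushin.grushinBasis (Grushin.grushinS s)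
      (fun i => (Grushin.Idx.energy s i : ℂ)) (Grushin.repr_grushinS s)
      (Grushin.mem_domain_of_summable s) (Grushin.finite_energy_le s)]
    ext z
    constructor
    · rintro ⟨i, rfl⟩
      exact ⟨i.2, i.1, i.1.2, rfl⟩
    · rintro ⟨n, k, hk, rfl⟩
      exact ⟨(⟨k, hk⟩, n), rfl⟩
  · rw [Grushin.grushinBasis_apply, Grushin.eigenfn_eq_mode]
    exact Grushin.coeFn_modeL (Grushin.abs_pos_of_idx k) _ _
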